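/- Let $(E,d)$ be a complete separable metric space with its Borel $\sigma$-algebra, and let $(\Omega,\mathcal F,(\mathcal F_{s,t})_{s\le t},\mathbb P,\theta,\varphi)$ be a white-noise random dynamical system on $E$. That is: - $(\Omega,\mathcal F,\mathbb P)$ is a probability space and $\theta=(\theta_t)_{t\in\mathbb R}$ is a jointly measurable group of maps of $\Omega$ that preserves $\mathbb P$ and is ergodic; - $\varphi:\mathbb R_+\times\Omega\times E\to E$ is measurable, $x\mapsto\varphi_t(\omega,x)$ is continuous, $\varphi_0(\omega,x)=x$, and $\varphi_{t+s}(\omega,x)=\varphi_t(\theta_s\omega,\varphi_s(\omega,x))$ for all $s,t\ge0$, $\omega\in\Omega$, $x\in E$; - $\mathcal F_{s,t}\subseteq\mathcal F$ ($s\le t$) are $\sigma$-algebras with $\mathcal F_{t,u}\subseteq\mathcal F_{s,v}$ for $s\le t\le u\le v$, with $\theta_r^{-1}(\mathcal F_{s,t})=\mathcal F_{s+r,t+r}$ for all $r$, and with $\mathcal F_{t_0,t_1},\dots,\mathcal F_{t_{n-1},t_n}$ independent for all $t_0\le\dots\le t_n$; and $\varphi_s(\cdot,x)$ is $\mathcal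 F_{0,s}$-measurable for all $s\ge0$, $x\in E$. Let $\mathcal F_0:=\sigma(\mathcal F_{s,0}:s\le0)$, and let $\rho$ be a probability measure on $E$ that is invariant for the Markovian semigroup $P_tf(x)=\mathbb E f(\varphi_t(\cdot,x))$. Assume that $\varphi$ satisfies weak global pointwise stability: there are a Borel set $U\subseteq E$ with $\rho(U)=1$ and a sequence $t_n\uparrow\infty$ such that for all $x,y\in U$ there is $\delta(x,y)>0$ with $$\liminf_{n\to\infty}\mathbb P\big(d(\varphi_{t_n}(\cdot,x),\varphi_{t_n}(\cdot,y))\le\eta\big)\ge\delta(x,y)\qquad\text{for all }\eta>0.$$ Then the statistical equilibrium is supported by a single random point. Precisely: there is a family of probability measures $(\mu_\omega)_{\omega\in\Omega}$ on $E$ such that for every sequence $t_k\to\infty$, $\mathbb P$-almost surely, the image measures $\varphi_{t_k}(\theta_{-t_k}\omega)\rho$ converge weakly to $\mu_\omega$ (the statistical equilibrium); and for every such family there is an $\mathcal F_0$-measurable map $a:\Omega\to E$ with $\mu_\omega=\delta_{a(\omega)}$ for $\mathbb P$-almost every $\omega$. -/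

import Mathlib

open MeasureTheory ProbabilityTheory Filter Topology
open scoped NNReal ENNReal BoundedContinuousFunction

/-- `(Ω, 𝓐, P, θ)` is an ergodic metric dynamical system: `θ` is a jointly measurable
one-parameter group of maps of `Ω` which leaves `P` invariant and is ergodic. -/
structure IsErgodicMDS {Ω : Type*} [MeasurableSpace Ω] (P : Measure Ω) (θ : ℝ → Ω → Ω) :
    Prop where
  measurable_shift : Measurable (fun p : ℝ × Ω => θ p.1 p.2)
  shift_zero : ∀ ω, θ 0 ω = ω
  shift_add : ∀ s t ω, θ (s + t) ω = θ s (θ t ω)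
  measurePreserving : ∀ t, MeasurePreserving (θ t) P P
  ergodic : ∀ A : Set Ω, MeasurableSet A → (∀ t, θ t ⁻¹' A = A) → P A = 0 ∨ P A = 1

/-- A random dynamical system with state space `E`: an ergodic metric dynamical system together
with a measurable perfect cocycle `φ` over it which is continuous in the space variable. -/
structure IsRDS {Ω E : Type*} [MeasurableSpace Ω] [TopologicalSpace E] [MeasurableSpace E]
    (P : Measure Ω) (θ : ℝ → Ω → Ω) (φ : ℝ≥0 → Ω → E → E) : Prop
    extends IsErgodicMDS P θ where
  measurable_cocycle : Measurable (fun p : ℝ≥0 × Ω × E => φ p.1 p.2.1 p.2.2)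
  cocycle_zero : ∀ ω x, φ 0 ω x = x
  cocycle_add : ∀ (t s : ℝ≥0) (ω : Ω) (x : E), φ (t + s) ω x = φ t (θ (s : ℝ) ω) (φ s ω x)
  continuous_cocycle : ∀ s ω, Continuous (φ s ω)

/-- A white noise (filtered) RDS. Only the values `ℱ s t` with `s ≤ t` matter. -/
structure IsWhiteNoiseRDS {Ω E : Type*} [mΩ : MeasurableSpace Ω] [TopologicalSpace E]
    [MeasurableSpace E] (P : Measure Ω) (θ : ℝ → Ω → Ω) (φ : ℝ≥0 → Ω → E → E)
    (ℱ : ℝ → ℝ → MeasurableSpace Ω) : Prop extends IsRDS P θ φ where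
  le_ambient : ∀ s t, s ≤ t → ℱ s t ≤ mΩ
  mono : ∀ s t u v, s ≤ t → t ≤ u → u ≤ v → ℱ t u ≤ ℱ s v
  comap_shift : ∀ r s t, s ≤ t → (ℱ s t).comap (θ r) = ℱ (s + r) (t + r)
  iIndep_increments : ∀ (n : ℕ) (t : Fin (n + 1) → ℝ), Monotone t →
    iIndep (fun i : Fin n => ℱ (t i.castSucc) (t i.succ)) P
  adapted : ∀ (s : ℝ≥0) (x : E), Measurable[ℱ 0 (s : ℝ)] (fun ω => φ s ω x)

/-- The σ-algebra `ℱ_t` generated by all `ℱ s t`, `s ≤ t`. -/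
abbrev pastSigma {Ω : Type*} (ℱ : ℝ → ℝ → MeasurableSpace Ω) (t : ℝ) : MeasurableSpace Ω :=
  ⨆ (s : ℝ) (_ : s ≤ t), ℱ s t

/-- The associated Markovian semigroup `P_t f(x) = 𝔼 f(φ_t(·, x))`. -/
noncomputable def markovSemigroup {Ω E : Type*} [MeasurableSpace Ω] (P : Measure Ω)
    (φ : ℝ≥0 → Ω → E → E) (t : ℝ≥0) (f : E → ℝ) (x : E) : ℝ :=
  ∫ ω, f (φ t ω x) ∂P

/-- `ρ` is invariant for the associated Markovian semigroup. -/
def IsInvariantLaw {Ω E : Type*} [MeasurableSpace Ω] [MeasurableSpace E] (P : Measure Ω)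
    (φ : ℝ≥0 → Ω → E → E) (ρ : Measure E) : Prop :=
  ∀ (t : ℝ≥0) (f : E → ℝ), Measurable f → (∃ C : ℝ, ∀ x, |f x| ≤ C) →
    ∫ x, markovSemigroup P φ t f x ∂ρ = ∫ x, f x ∂ρ

/-- The random measure `φ_t(θ_{-t} ω) ρ`, the image of `ρ` under `φ_t(θ_{-t} ω, ·)`. -/
noncomputable def pullbackImage {Ω E : Type*} [MeasurableSpace E] (θ : ℝ → Ω → Ω)
    (φ : ℝ≥0 → Ω → E → E) (ρ : Measure E) (t : ℝ≥0) (ω : Ω) : Measure E :=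
  ρ.map (φ t (θ (-(t : ℝ)) ω))

/-- `μ` is (a version of) the statistical equilibrium: for every sequence `t_k → ∞`, almost
surely, `φ_{t_k}(θ_{-t_k} ω) ρ` converges to the probability measure `μ ω` weakly, i.e. tested
against all bounded continuous functions. -/
def IsStatisticalEquilibrium {Ω E : Type*} [MeasurableSpace Ω] [TopologicalSpace E]
    [MeasurableSpace E] (P : Measure Ω) (θ : ℝ → Ω → Ω) (φ : ℝ≥0 → Ω → E → E)
    (ρ : Measure E) (μ : Ω → ProbabilityMeasure E) : Prop :=
  ∀ t : ℕ → ℝ≥0, Tendsto t atTop atTop → ∀ᵐ ω ∂P, ∀ f : E →ᵇ ℝ,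
    Tendsto (fun k => ∫ y, f y ∂(pullbackImage θ φ ρ (t k) ω)) atTop
      (𝓝 (∫ y, f y ∂(μ ω : Measure E)))

/-- Pointwise stability on a set `U` along some sequence `t_n ↑ ∞`: every pair of points of `U`
gets arbitrarily close with asymptotic probability at least some `δ(x, y) > 0` (which does not
depend on the required closeness `η`). -/
def IsPointwiseStableOn {Ω E : Type*} [MeasurableSpace Ω] [PseudoMetricSpace E]
    (P : Measure Ω) (φ : ℝ≥0 → Ω → E → E) (U : Set E) : Prop :=
  ∃ t : ℕ → ℝ≥0, Monotone t ∧ Tendsto t atTop atTop ∧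
    ∀ x ∈ U, ∀ y ∈ U, ∃ δ : ℝ, 0 < δ ∧ ∀ η : ℝ, 0 < η →
      ENNReal.ofReal δ ≤ liminf (fun n => P {ω | dist (φ (t n) ω x) (φ (t n) ω y) ≤ η}) atTop

/-- Weak global pointwise stability: pointwise stability on a Borel set of full `ρ`-measure. -/
def WeakGlobalPointwiseStability {Ω E : Type*} [MeasurableSpace Ω] [PseudoMetricSpace E]
    [MeasurableSpace E] (P : Measure Ω) (φ : ℝ≥0 → Ω → E → E) (ρ : Measure E) : Prop :=
  ∃ U : Set E, MeasurableSet U ∧ ρ U = 1 ∧ IsPointwiseStableOn P φ U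

set_option linter.unusedSectionVars false

/-! Write `μ_t(ω)` for the image of `ρ` under the flow from time `-t` to time `0`. Invariance of `ρ`
and independence of the noise on disjoint intervals make `μ_t(B)` a bounded martingale in `t` for
each Borel `B`, so it converges almost surely along every sequence of times. The problem is to show
that the limit is `0` or `1`.

The tool is the two-point motion started from `ρ ⊗ ρ`, whose law at time `t` integrates `F ⊗ G` to
`𝔼[μ_t(F) μ_t(G)]`. Its marginals are always `ρ`, so the laws are tight and have a weak limit `κ₀`
along a subsequence. By the martingale property `𝔼[μ_t(F)²]` increases in `t`; hence its limit does
not depend on the subsequence, and polarization of these squares determines `κ₀`. Shifting the times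
by `t` gives the same limit, so by the Markov and Feller properties `κ₀` is stationary
(`twoPointLaw_eq_of_tendsto`).

A stationary law cannot lose mass near the diagonal, while the diagonal itself is preserved.
Pointwise stability would bring a fixed fraction of any off-diagonal mass arbitrarily close to the
diagonal, so there is none (`measure_ne_eq_zero_of_isPointwiseStableOn`). Therefore `𝔼[μ_t(B)
μ_t(Bᶜ)]` vanishes in the limit, which is the zero-one law. Applied to countable covers by balls of
radius `2^(-j)`, it singles out balls of asymptotically full mass; their centres converge to the
random point (`exists_random_point`). -/

/-! ### Decoupling of independent arguments. -/

theorem ProbabilityTheory.IndepFun.lintegral_diag {Ω α β : Type*} {mΩ : MeasurableSpace Ω}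
    {mα : MeasurableSpace α} {mβ : MeasurableSpace β} {P : Measure Ω} [IsFiniteMeasure P]
    {X : Ω → α} {Y : Ω → β} (hX : Measurable X) (hY : Measurable Y) (h : IndepFun X Y P)
    {G : α × β → ℝ≥0∞} (hG : Measurable G) :
    ∫⁻ ω, G (X ω, Y ω) ∂P = ∫⁻ ω, ∫⁻ ω', G (X ω, Y ω') ∂P ∂P := by
  have h1 := (indepFun_iff_map_prod_eq_prod_map_map hX.aemeasurable hY.aemeasurable).1 h
  calc ∫⁻ ω, G (X ω, Y ω) ∂P = ∫⁻ p, G p ∂(P.map fun ω => (X ω, Y ω)) :=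
        (lintegral_map hG (hX.prodMk hY)).symm
    _ = ∫⁻ a, ∫⁻ b, G (a, b) ∂(P.map Y) ∂(P.map X) := by
        rw [h1, lintegral_prod _ hG.aemeasurable]
    _ = ∫⁻ ω, ∫⁻ ω', G (X ω, Y ω') ∂P ∂P := by
        rw [lintegral_map hG.lintegral_prod_right' hX]
        refine lintegral_congr fun ω => ?_
        exact lintegral_map (hG.comp measurable_prodMk_left) hY

/-- Integrating over the diagonal decouples the two arguments when they are measurable with
respect to independent σ-algebras. -/
theorem ProbabilityTheory.Indep.lintegral_diag {Ω : Type*} {mΩ : MeasurableSpace Ω}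
    {P : Measure Ω} [IsFiniteMeasure P] {m₁ m₂ : MeasurableSpace Ω} (h₁ : m₁ ≤ mΩ) (h₂ : m₂ ≤ mΩ)
    (h : Indep m₁ m₂ P) {G : Ω → Ω → ℝ≥0∞}
    (hG : Measurable[m₁.prod m₂] (fun p : Ω × Ω => G p.1 p.2)) :
    ∫⁻ ω, G ω ω ∂P = ∫⁻ ω, ∫⁻ ω', G ω ω' ∂P ∂P := by
  -- The two random variables are the identity maps from `Ω` to `(Ω, m₁)` and to `(Ω, m₂)`.
  refine @IndepFun.lintegral_diag Ω Ω Ω mΩ m₁ m₂ P _ id id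
    (fun s hs => h₁ s hs) (fun s hs => h₂ s hs) ?_ (fun p => G p.1 p.2) hG
  rw [@IndepFun_iff_Indep _ _ _ mΩ m₁ m₂]
  simpa using h

/-! ### Increments of a white-noise system. -/

namespace IsWhiteNoiseRDS

variable {Ω E : Type*} [mΩ : MeasurableSpace Ω] [TopologicalSpace E] [mE : MeasurableSpace E]
  {P : Measure Ω} {θ : ℝ → Ω → Ω} {φ : ℝ≥0 → Ω → E → E} {ℱ : ℝ → ℝ → MeasurableSpace Ω}

theorem indep_increments (hφ : IsWhiteNoiseRDS P θ φ ℱ) {r s t : ℝ} (hrs : r ≤ s) (hst : s ≤ t) :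
    Indep (ℱ r s) (ℱ s t) P := by
  have h := hφ.iIndep_increments 2 ![r, s, t] (by
    refine Fin.monotone_iff_le_succ.2 fun i => ?_
    fin_cases i <;> simpa)
  simpa using h.indep (i := 0) (j := 1) (by simp)

theorem measurable_shift_const (hφ : IsWhiteNoiseRDS P θ φ ℱ) (r : ℝ) : Measurable (θ r) :=
  (hφ.measurePreserving r).measurable

theorem measurable_cocycle_apply (hφ : IsWhiteNoiseRDS P θ φ ℱ) (s : ℝ≥0) :
    Measurable (fun p : Ω × E => φ s p.1 p.2) :=
  hφ.measurable_cocycle.comp (measurable_const.prodMk measurable_id)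

/-- The flow from `-(s + t)` to `0` is split at time `-s`: the older noise acts first. -/
theorem pullback_add (hφ : IsWhiteNoiseRDS P θ φ ℱ) (s t : ℝ≥0) (ω : Ω) (x : E) :
    φ (s + t) (θ (-((s + t : ℝ≥0) : ℝ)) ω) x
      = φ s (θ (-s) ω) (φ t (θ (-((s + t : ℝ≥0) : ℝ)) ω) x) := by
  rw [hφ.cocycle_add, ← hφ.shift_add]
  congr 2
  push_cast
  ring_nf

/-- Shift covariance turns adaptedness on `[0, s]` into adaptedness on `[r, s + r]`. Continuity in
space upgrades measurability at each point to joint measurability, still with respect to the small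
σ-algebra; independence can only be used in that form. -/
theorem measurable_increment [TopologicalSpace.MetrizableSpace E] [SecondCountableTopology E]
    [BorelSpace E] (hφ : IsWhiteNoiseRDS P θ φ ℱ) (s : ℝ≥0) (r : ℝ) :
    Measurable[(ℱ r (s + r)).prod mE] (fun p : Ω × E => φ s (θ r p.1) p.2) := by
  have h1 : ∀ x, Measurable[ℱ r (s + r)] (fun ω => φ s (θ r ω) x) := fun x => by
    have h := hφ.comap_shift r 0 s s.2
    rw [zero_add] at h
    rw [← h]
    exact (hφ.adapted s x).comp (comap_measurable (θ r))
  have h2 := @measurable_uncurry_of_continuous_of_measurable Ω E E _ _ _ _ _ _ _ _ _ (ℱ r (s + r))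
    (fun x ω => φ s (θ r ω) x) (fun ω => hφ.continuous_cocycle s (θ r ω)) h1
  exact h2.comp (@measurable_swap _ _ (ℱ r (s + r)) mE)

end IsWhiteNoiseRDS

/-! ### Consequences of invariance of `ρ`. -/

section Invariant

variable {Ω E : Type*} [mΩ : MeasurableSpace Ω] [MetricSpace E] [SecondCountableTopology E]
  [mE : MeasurableSpace E] [BorelSpace E] {P : Measure Ω} [IsProbabilityMeasure P]
  {θ : ℝ → Ω → Ω} {φ : ℝ≥0 → Ω → E → E} {ℱ : ℝ → ℝ → MeasurableSpace Ω}
  {ρ : Measure E} [IsProbabilityMeasure ρ]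

theorem map_prod_eq_of_isInvariantLaw (hφ : IsWhiteNoiseRDS P θ φ ℱ)
    (hρ : IsInvariantLaw P φ ρ) (t : ℝ≥0) :
    (P.prod ρ).map (fun p : Ω × E => φ t p.1 p.2) = ρ := by
  have hm := hφ.measurable_cocycle_apply t
  have : IsProbabilityMeasure ((P.prod ρ).map (fun p : Ω × E => φ t p.1 p.2)) :=
    Measure.isProbabilityMeasure_map hm.aemeasurable
  ext B hB
  have hf : Measurable (B.indicator (fun _ => (1 : ℝ))) := measurable_const.indicator hB
  have h := hρ t (B.indicator fun _ => 1) hf ⟨1, fun x => by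
    by_cases hx : x ∈ B <;> simp [hx]⟩
  have h1 : ∫ x, B.indicator (fun _ => (1 : ℝ)) x ∂ρ = ρ.real B := by
    simp [integral_indicator hB]
  have h2 : ∫ x, markovSemigroup P φ t (B.indicator fun _ => 1) x ∂ρ
      = ((P.prod ρ).map (fun p : Ω × E => φ t p.1 p.2)).real B := by
    unfold markovSemigroup
    have hi : Integrable (fun p : E × Ω => B.indicator (fun _ => (1 : ℝ)) (φ t p.2 p.1))
        (ρ.prod P) := by
      refine Integrable.of_bound (C := 1)
        ((hf.comp (hm.comp measurable_swap)).aestronglyMeasurable) (.of_forall fun p => ?_)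
      by_cases hx : φ t p.2 p.1 ∈ B <;> simp [hx]
    rw [← integral_prod _ hi, ← Measure.prod_swap, integral_map measurable_swap.aemeasurable
      (by rw [Measure.prod_swap]; exact hi.1)]
    have := integral_map (μ := P.prod ρ) hm.aemeasurable
      (f := B.indicator (fun _ => (1 : ℝ))) hf.aestronglyMeasurable
    simp only [Prod.fst_swap, Prod.snd_swap]
    rw [← this]
    simp [integral_indicator hB]
  rw [h1, h2] at h
  exact (measureReal_eq_measureReal_iff).1 h

theorem lintegral_cocycle_of_isInvariantLaw (hφ : IsWhiteNoiseRDS P θ φ ℱ)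
    (hρ : IsInvariantLaw P φ ρ) (t : ℝ≥0) (r : ℝ) {f : E → ℝ≥0∞} (hf : Measurable f) :
    ∫⁻ ω, ∫⁻ x, f (φ t (θ r ω) x) ∂ρ ∂P = ∫⁻ x, f x ∂ρ := by
  have hm := hφ.measurable_cocycle_apply t
  have h1 : Measurable fun ω => ∫⁻ x, f (φ t ω x) ∂ρ := (hf.comp hm).lintegral_prod_right'
  rw [(hφ.measurePreserving r).lintegral_comp h1]
  conv_rhs => rw [← map_prod_eq_of_isInvariantLaw hφ hρ t]
  rw [lintegral_map hf hm]
  exact (lintegral_prod _ (hf.comp hm).aemeasurable).symm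

/-- Conditionally on `ℱ (-s) 0`, the image of `ρ` under the flow on `[-s - t, -s]` is again
distributed according to `ρ`. -/
theorem lintegral_pullback_past (hφ : IsWhiteNoiseRDS P θ φ ℱ) (hρ : IsInvariantLaw P φ ρ)
    (s t : ℝ≥0) {G : Ω → E → ℝ≥0∞}
    (hG : Measurable[(ℱ (-s) 0).prod mE] (fun p : Ω × E => G p.1 p.2)) :
    ∫⁻ ω, ∫⁻ x, G ω (φ t (θ (-((s + t : ℝ≥0) : ℝ)) ω) x) ∂ρ ∂P
      = ∫⁻ ω, ∫⁻ x, G ω x ∂ρ ∂P := by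
  set r : ℝ := -((s + t : ℝ≥0) : ℝ) with hr
  have hrs : (t : ℝ) + r = -s := by rw [hr]; push_cast; ring
  have hinc := hφ.measurable_increment t r
  rw [hrs] at hinc
  have hle : r ≤ -s := by rw [← hrs]; simp
  have hs0 : -(s : ℝ) ≤ 0 := by simp
  have hGm : Measurable (fun p : Ω × E => G p.1 p.2) :=
    hG.mono (sup_le_sup (MeasurableSpace.comap_mono (hφ.le_ambient _ _ hs0)) le_rfl) le_rfl
  -- `ω` carries the noise on `[-s, 0]` and `ω'` the independent noise on `[r, -s]`; once decoupled,
  -- the latter integrates out by invariance.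
  have key := (hφ.indep_increments hle hs0).symm.lintegral_diag
    (hφ.le_ambient _ _ hs0) (hφ.le_ambient _ _ hle)
    (G := fun ω ω' => ∫⁻ x, G ω (φ t (θ r ω') x) ∂ρ) ?_
  · rw [key]
    refine lintegral_congr fun ω => ?_
    exact lintegral_cocycle_of_isInvariantLaw hφ hρ t r (hGm.comp measurable_prodMk_left)
  · let m : MeasurableSpace (Ω × Ω) := (ℱ (-s) 0).prod (ℱ r (-s))
    refine @Measurable.lintegral_prod_right' (Ω × Ω) E m mE ρ _
      (fun q => G q.1.1 (φ t (θ r q.1.2) q.2)) ?_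
    have hfst : Measurable[m.prod mE, ℱ (-s) 0] (fun q : (Ω × Ω) × E => q.1.1) :=
      (@measurable_fst Ω Ω (ℱ (-s) 0) (ℱ r (-s))).comp (@measurable_fst (Ω × Ω) E m mE)
    have hsnd : Measurable[m.prod mE, ℱ r (-s)] (fun q : (Ω × Ω) × E => q.1.2) :=
      (@measurable_snd Ω Ω (ℱ (-s) 0) (ℱ r (-s))).comp (@measurable_fst (Ω × Ω) E m mE)
    have h3 : Measurable[m.prod mE, (ℱ r (-s)).prod mE]
        (fun q : (Ω × Ω) × E => (q.1.2, q.2)) :=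
      @Measurable.prodMk _ _ _ _ (ℱ r (-s)) mE _ _ hsnd
        (@measurable_snd (Ω × Ω) E m mE)
    exact hG.comp (@Measurable.prodMk _ _ _ _ (ℱ (-s) 0) mE _ _ hfst (hinc.comp h3))

end Invariant

/-! ### Test functions determining measures on a product. -/

/-- A finite measure on a product is determined by the integrals of products of nonnegative
bounded continuous functions. -/
theorem MeasureTheory.Measure.ext_of_lintegral_nnreal_mul {X Y : Type*} [TopologicalSpace X]
    [MeasurableSpace X] [BorelSpace X] [HasOuterApproxClosed X] [TopologicalSpace Y]
    [MeasurableSpace Y] [BorelSpace Y] [HasOuterApproxClosed Y] {μ ν : Measure (X × Y)}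
    [IsFiniteMeasure μ] [IsFiniteMeasure ν]
    (h : ∀ (F : X →ᵇ ℝ≥0) (G : Y →ᵇ ℝ≥0),
      ∫⁻ p, (F p.1 : ℝ≥0∞) * G p.2 ∂μ = ∫⁻ p, (F p.1 : ℝ≥0∞) * G p.2 ∂ν) : μ = ν := by
  have hm : ∀ (F : X →ᵇ ℝ≥0) (G : Y →ᵇ ℝ≥0),
      Measurable (fun p : X × Y => (F p.1 : ℝ) * G p.2) := fun F G =>
    (F.continuous.measurable.comp measurable_fst).coe_nnreal_real.mul
      (G.continuous.measurable.comp measurable_snd).coe_nnreal_real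
  have hi : ∀ (κ : Measure (X × Y)) [IsFiniteMeasure κ] (F : X →ᵇ ℝ≥0) (G : Y →ᵇ ℝ≥0),
      Integrable (fun p : X × Y => (F p.1 : ℝ) * G p.2) κ := fun κ _ F G => by
    refine Integrable.of_bound (C := nndist F 0 * nndist G 0)
      (hm F G).aestronglyMeasurable (.of_forall fun p => ?_)
    rw [norm_mul, NNReal.norm_eq, NNReal.norm_eq]
    gcongr
    · exact_mod_cast BoundedContinuousFunction.NNReal.upper_bound F p.1
    · exact_mod_cast BoundedContinuousFunction.NNReal.upper_bound G p.2
  have hr : ∀ (F : X →ᵇ ℝ≥0) (G : Y →ᵇ ℝ≥0),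
      ∫ p, (F p.1 : ℝ) * G p.2 ∂μ = ∫ p, (F p.1 : ℝ) * G p.2 ∂ν := fun F G => by
    rw [integral_eq_lintegral_of_nonneg_ae (.of_forall fun p => by positivity)
        (hm F G).aestronglyMeasurable,
      integral_eq_lintegral_of_nonneg_ae (.of_forall fun p => by positivity)
        (hm F G).aestronglyMeasurable]
    simpa [ENNReal.ofReal_mul] using congrArg ENNReal.toReal (h F G)
  refine Measure.ext_of_integral_mul_boundedContinuousFunction fun f g => ?_
  have hf : ∀ x, f x = f.nnrealPart x - (-f).nnrealPart x := fun x =>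
    congrFun f.self_eq_nnrealPart_sub_nnrealPart_neg x
  have hg : ∀ x, g x = g.nnrealPart x - (-g).nnrealPart x := fun x =>
    congrFun g.self_eq_nnrealPart_sub_nnrealPart_neg x
  have hexp : ∀ (κ : Measure (X × Y)) [IsFiniteMeasure κ], ∫ p, f p.1 * g p.2 ∂κ
      = (∫ p, (f.nnrealPart p.1 : ℝ) * g.nnrealPart p.2 ∂κ
        - ∫ p, (f.nnrealPart p.1 : ℝ) * (-g).nnrealPart p.2 ∂κ)
        - (∫ p, ((-f).nnrealPart p.1 : ℝ) * g.nnrealPart p.2 ∂κ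
        - ∫ p, ((-f).nnrealPart p.1 : ℝ) * (-g).nnrealPart p.2 ∂κ) := fun κ _ => by
    rw [← integral_sub (hi κ _ _) (hi κ _ _), ← integral_sub (hi κ _ _) (hi κ _ _)]
    refine Eq.trans ?_
      (integral_sub ((hi κ _ _).sub (hi κ _ _)) ((hi κ _ _).sub (hi κ _ _)))
    refine integral_congr_ae (.of_forall fun p => ?_)
    simp only [hf p.1, hg p.2]
    ring
  rw [hexp μ, hexp ν, hr, hr, hr, hr]

/-- Two symmetric finite measures on a square agree if they integrate all squares `F ⊗ F` to
the same value. -/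
theorem MeasureTheory.Measure.ext_of_lintegral_mul_self {X : Type*} [TopologicalSpace X]
    [MeasurableSpace X] [BorelSpace X] [HasOuterApproxClosed X] {μ ν : Measure (X × X)}
    [IsFiniteMeasure μ] [IsFiniteMeasure ν]
    (hμ : ∀ F G : X →ᵇ ℝ≥0,
      ∫⁻ p, (F p.1 : ℝ≥0∞) * G p.2 ∂μ = ∫⁻ p, (G p.1 : ℝ≥0∞) * F p.2 ∂μ)
    (hν : ∀ F G : X →ᵇ ℝ≥0,
      ∫⁻ p, (F p.1 : ℝ≥0∞) * G p.2 ∂ν = ∫⁻ p, (G p.1 : ℝ≥0∞) * F p.2 ∂ν)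
    (h : ∀ F : X →ᵇ ℝ≥0,
      ∫⁻ p, (F p.1 : ℝ≥0∞) * F p.2 ∂μ = ∫⁻ p, (F p.1 : ℝ≥0∞) * F p.2 ∂ν) : μ = ν := by
  refine Measure.ext_of_lintegral_nnreal_mul fun F G => ?_
  have hm : ∀ F G : X →ᵇ ℝ≥0, Measurable (fun p : X × X => (F p.1 : ℝ≥0∞) * G p.2) :=
    fun F G => (F.continuous.measurable.comp measurable_fst).coe_nnreal_ennreal.mul
      (G.continuous.measurable.comp measurable_snd).coe_nnreal_ennreal
  have hfin : ∀ (κ : Measure (X × X)) [IsFiniteMeasure κ] (F G : X →ᵇ ℝ≥0),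
      ∫⁻ p, (F p.1 : ℝ≥0∞) * G p.2 ∂κ ≠ ∞ := fun κ _ F G => by
    refine ((lintegral_mono fun p => ?_).trans_lt
      (lintegral_const_lt_top (μ := κ) (c := (nndist F 0 : ℝ≥0∞) * nndist G 0)
        (by finiteness))).ne
    gcongr
    · exact_mod_cast BoundedContinuousFunction.NNReal.upper_bound F p.1
    · exact_mod_cast BoundedContinuousFunction.NNReal.upper_bound G p.2
  have hexp : ∀ (κ : Measure (X × X)),
      (∀ F G : X →ᵇ ℝ≥0,
        ∫⁻ p, (F p.1 : ℝ≥0∞) * G p.2 ∂κ = ∫⁻ p, (G p.1 : ℝ≥0∞) * F p.2 ∂κ) →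
      ∫⁻ p, ((F + G) p.1 : ℝ≥0∞) * (F + G) p.2 ∂κ
        = ∫⁻ p, (F p.1 : ℝ≥0∞) * F p.2 ∂κ + ∫⁻ p, (G p.1 : ℝ≥0∞) * G p.2 ∂κ
          + 2 * ∫⁻ p, (F p.1 : ℝ≥0∞) * G p.2 ∂κ := fun κ hκ => by
    rw [two_mul]
    nth_rw 2 [hκ F G]
    rw [← lintegral_add_left (hm F F), ← lintegral_add_left (hm F G)]
    refine Eq.trans (lintegral_congr fun p => ?_)
      (lintegral_add_left ((hm F F).add (hm G G)) _)
    simp only [BoundedContinuousFunction.coe_add, Pi.add_apply, ENNReal.coe_add]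
    ring
  -- Polarization: symmetry merges the two cross terms of the square of `F + G`.
  have h1 := h (F + G)
  rw [hexp μ hμ, hexp ν hν, h F, h G] at h1
  have h2 := (ENNReal.add_right_inj (ENNReal.add_ne_top.2 ⟨hfin ν F F, hfin ν G G⟩)).1 h1
  exact (ENNReal.mul_right_inj (by norm_num) (by norm_num)).1 h2

/-! ### The two-point motion. -/

/-- The law at time `t` of the two-point motion started from the law `κ`. -/
noncomputable def twoPointLaw {Ω E : Type*} [MeasurableSpace Ω] [MeasurableSpace E]
    (P : Measure Ω) (φ : ℝ≥0 → Ω → E → E) (t : ℝ≥0) (κ : Measure (E × E)) : Measure (E × E) :=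
  (P.prod κ).map (fun q => (φ t q.1 q.2.1, φ t q.1 q.2.2))

section TwoPoint

variable {Ω E : Type*} [mΩ : MeasurableSpace Ω] [MetricSpace E] [SecondCountableTopology E]
  [mE : MeasurableSpace E] [BorelSpace E] {P : Measure Ω} [IsProbabilityMeasure P]
  {θ : ℝ → Ω → Ω} {φ : ℝ≥0 → Ω → E → E} {ℱ : ℝ → ℝ → MeasurableSpace Ω}

theorem IsWhiteNoiseRDS.measurable_twoPoint (hφ : IsWhiteNoiseRDS P θ φ ℱ) (t : ℝ≥0) :
    Measurable (fun q : Ω × E × E => (φ t q.1 q.2.1, φ t q.1 q.2.2)) :=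
  ((hφ.measurable_cocycle_apply t).comp
    (measurable_fst.prodMk (measurable_fst.comp measurable_snd))).prodMk
  ((hφ.measurable_cocycle_apply t).comp
    (measurable_fst.prodMk (measurable_snd.comp measurable_snd)))

theorem isProbabilityMeasure_twoPointLaw (hφ : IsWhiteNoiseRDS P θ φ ℱ) (t : ℝ≥0)
    (κ : Measure (E × E)) [IsProbabilityMeasure κ] :
    IsProbabilityMeasure (twoPointLaw P φ t κ) :=
  Measure.isProbabilityMeasure_map (hφ.measurable_twoPoint t).aemeasurable

theorem lintegral_twoPointLaw (hφ : IsWhiteNoiseRDS P θ φ ℱ) (t : ℝ≥0) (κ : Measure (E × E))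
    [IsFiniteMeasure κ] {f : E × E → ℝ≥0∞} (hf : Measurable f) :
    ∫⁻ p, f p ∂(twoPointLaw P φ t κ) = ∫⁻ p, ∫⁻ ω, f (φ t ω p.1, φ t ω p.2) ∂P ∂κ := by
  have hm := hf.comp (hφ.measurable_twoPoint t)
  rw [twoPointLaw, lintegral_map hf (hφ.measurable_twoPoint t)]
  exact lintegral_prod_symm _ hm.aemeasurable

theorem lintegral_twoPointLaw' (hφ : IsWhiteNoiseRDS P θ φ ℱ) (t : ℝ≥0) (κ : Measure (E × E))
    [IsFiniteMeasure κ] {f : E × E → ℝ≥0∞} (hf : Measurable f) :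
    ∫⁻ p, f p ∂(twoPointLaw P φ t κ) = ∫⁻ ω, ∫⁻ p, f (φ t ω p.1, φ t ω p.2) ∂κ ∂P := by
  have hm := hf.comp (hφ.measurable_twoPoint t)
  rw [twoPointLaw, lintegral_map hf (hφ.measurable_twoPoint t)]
  exact lintegral_prod _ hm.aemeasurable

/-- This is the Markov property of the two-point motion: the noise on `[s, t + s]` is independent of
that on `[0, s]`, and the shift preserves `P`. -/
theorem twoPointLaw_add (hφ : IsWhiteNoiseRDS P θ φ ℱ) (s t : ℝ≥0) (κ : Measure (E × E))
    [IsProbabilityMeasure κ] :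
    twoPointLaw P φ (s + t) κ = twoPointLaw P φ t (twoPointLaw P φ s κ) := by
  have := isProbabilityMeasure_twoPointLaw hφ s κ
  ext B hB
  have hf : Measurable (B.indicator (1 : E × E → ℝ≥0∞)) := measurable_one.indicator hB
  rw [← lintegral_indicator_one hB, ← lintegral_indicator_one hB, lintegral_twoPointLaw hφ _ _ hf,
    lintegral_twoPointLaw hφ _ _ hf, lintegral_twoPointLaw hφ]
  swap
  · exact (hf.comp ((hφ.measurable_twoPoint t).comp measurable_swap)).lintegral_prod_right'
  refine lintegral_congr fun p => ?_
  have hs0 : (0 : ℝ) ≤ s := s.2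
  have hst : (s : ℝ) ≤ t + s := by simp
  have hinc := hφ.measurable_increment t s
  have key := (hφ.indep_increments hs0 hst).lintegral_diag
    (hφ.le_ambient _ _ hs0) (hφ.le_ambient _ _ hst)
    (G := fun ω ω' => B.indicator (1 : E × E → ℝ≥0∞)
      (φ t (θ s ω') (φ s ω p.1), φ t (θ s ω') (φ s ω p.2))) ?_
  · have hcoc : ∀ ω x, φ (s + t) ω x = φ t (θ s ω) (φ s ω x) := fun ω x => by
      rw [add_comm, hφ.cocycle_add]
    simp only [hcoc]
    rw [key]
    refine lintegral_congr fun ω => ?_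
    exact (hφ.measurePreserving s).lintegral_comp
      (f := fun ω' => B.indicator (1 : E × E → ℝ≥0∞)
        (φ t ω' (φ s ω p.1), φ t ω' (φ s ω p.2)))
      (hf.comp ((hφ.measurable_twoPoint t).comp
        (measurable_prodMk_right : Measurable fun ω' : Ω => (ω', φ s ω p.1, φ s ω p.2))))
  · let m : MeasurableSpace (Ω × Ω) := (ℱ 0 s).prod (ℱ s (t + s))
    have h1 : ∀ x : E, Measurable[m] (fun q : Ω × Ω => φ t (θ s q.2) (φ s q.1 x)) := fun x =>
      hinc.comp (@Measurable.prodMk _ m _ _ (ℱ s (t + s)) mE _ _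
        (@measurable_snd Ω Ω (ℱ 0 s) (ℱ s (t + s)))
        ((hφ.adapted s x).comp (@measurable_fst Ω Ω (ℱ 0 s) (ℱ s (t + s)))))
    exact hf.comp ((h1 p.1).prodMk (h1 p.2))

/-- The Feller property of the two-point motion, in terms of laws. -/
theorem tendsto_twoPointLaw (hφ : IsWhiteNoiseRDS P θ φ ℱ) (t : ℝ≥0)
    {κ : ℕ → ProbabilityMeasure (E × E)} {κ₀ : ProbabilityMeasure (E × E)}
    (hκ : Tendsto κ atTop (𝓝 κ₀)) (f : E × E →ᵇ ℝ) :
    Tendsto (fun n => ∫ p, f p ∂(twoPointLaw P φ t (κ n))) atTop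
      (𝓝 (∫ p, f p ∂(twoPointLaw P φ t κ₀))) := by
  have hmf : ∀ p : E × E, Measurable fun ω => f (φ t ω p.1, φ t ω p.2) := fun p =>
    f.continuous.measurable.comp ((hφ.measurable_twoPoint t).comp measurable_prodMk_right)
  have hc : Continuous fun p : E × E => ∫ ω, f (φ t ω p.1, φ t ω p.2) ∂P := by
    refine continuous_of_dominated (bound := fun _ => ‖f‖)
      (fun p => (hmf p).aestronglyMeasurable)
      (fun p => .of_forall fun ω => f.norm_coe_le_norm _) (integrable_const _)
      (.of_forall fun ω => ?_)
    have := hφ.continuous_cocycle t ω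
    fun_prop
  let H : E × E →ᵇ ℝ := BoundedContinuousFunction.ofNormedAddCommGroup _ hc ‖f‖ fun p => by
    simpa using norm_integral_le_of_norm_le_const (μ := P) (C := ‖f‖)
      (f := fun ω => f (φ t ω p.1, φ t ω p.2)) (.of_forall fun ω => f.norm_coe_le_norm _)
  have hH : ∀ S : ProbabilityMeasure (E × E),
      ∫ p, f p ∂(twoPointLaw P φ t S) = ∫ p, H p ∂(S : Measure (E × E)) := fun S => by
    have hm := hφ.measurable_twoPoint t
    rw [twoPointLaw, integral_map hm.aemeasurable f.continuous.measurable.aestronglyMeasurable]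
    exact integral_prod_symm _ (Integrable.of_bound (C := ‖f‖)
      (f.continuous.measurable.comp hm).aestronglyMeasurable
      (.of_forall fun _ => f.norm_coe_le_norm _))
  simp only [hH]
  exact ProbabilityMeasure.tendsto_iff_forall_integral_tendsto.1 hκ H

variable {ρ : Measure E} [IsProbabilityMeasure ρ]

theorem fst_twoPointLaw_prod (hφ : IsWhiteNoiseRDS P θ φ ℱ) (hρ : IsInvariantLaw P φ ρ)
    (t : ℝ≥0) : (twoPointLaw P φ t (ρ.prod ρ)).fst = ρ := by
  ext B hB
  rw [Measure.fst_apply hB, ← lintegral_indicator_one (measurable_fst hB),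
    lintegral_twoPointLaw' hφ _ _ (measurable_one.indicator (measurable_fst hB)),
    ← lintegral_indicator_one hB]
  have hf : Measurable (B.indicator (1 : E → ℝ≥0∞)) := measurable_one.indicator hB
  rw [← lintegral_cocycle_of_isInvariantLaw hφ hρ t 0 hf]
  refine lintegral_congr fun ω => ?_
  rw [hφ.shift_zero]
  have := lintegral_prod (μ := ρ) (ν := ρ) (fun p => B.indicator (1 : E → ℝ≥0∞) (φ t ω p.1))
    (by
      refine (hf.comp ((hφ.measurable_cocycle_apply t).comp
        (measurable_const.prodMk measurable_fst))).aemeasurable)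
  simp only [lintegral_const, measure_univ, mul_one] at this
  rw [← this]
  rfl

/-- For fixed `ω` both points move under the same map from independent starting points, so the inner
integral factorizes. The shift `r` is free because `θ r` preserves `P`; `r = -t` gives the pulled
back measures. -/
theorem lintegral_twoPointLaw_prod_mul (hφ : IsWhiteNoiseRDS P θ φ ℱ) (t : ℝ≥0) (r : ℝ)
    {f g : E → ℝ≥0∞} (hf : Measurable f) (hg : Measurable g) :
    ∫⁻ p, f p.1 * g p.2 ∂(twoPointLaw P φ t (ρ.prod ρ))
      = ∫⁻ ω, (∫⁻ x, f (φ t (θ r ω) x) ∂ρ) * (∫⁻ x, g (φ t (θ r ω) x) ∂ρ) ∂P := by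
  have hm := hφ.measurable_cocycle_apply t
  have hm' : ∀ ω, Measurable (φ t ω) := fun ω => (hφ.continuous_cocycle t ω).measurable
  have hfg : Measurable fun p : E × E => f p.1 * g p.2 :=
    (hf.comp measurable_fst).mul (hg.comp measurable_snd)
  rw [lintegral_twoPointLaw' hφ _ _ hfg]
  rw [(hφ.measurePreserving r).lintegral_comp
    (f := fun ω => (∫⁻ x, f (φ t ω x) ∂ρ) * (∫⁻ x, g (φ t ω x) ∂ρ))
    ((hf.comp hm).lintegral_prod_right'.mul (hg.comp hm).lintegral_prod_right')]
  refine lintegral_congr fun ω => ?_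
  exact lintegral_prod_mul (hf.comp (hm' ω)).aemeasurable (hg.comp (hm' ω)).aemeasurable

theorem snd_twoPointLaw_prod (hφ : IsWhiteNoiseRDS P θ φ ℱ) (hρ : IsInvariantLaw P φ ρ)
    (t : ℝ≥0) : (twoPointLaw P φ t (ρ.prod ρ)).snd = ρ := by
  ext B hB
  have hf : Measurable (B.indicator (1 : E → ℝ≥0∞)) := measurable_one.indicator hB
  have h1 := lintegral_twoPointLaw_prod_mul (ρ := ρ) hφ t 0 measurable_one hf
  simp only [Pi.one_apply, one_mul, lintegral_const, measure_univ] at h1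
  rw [lintegral_cocycle_of_isInvariantLaw hφ hρ t 0 hf, lintegral_indicator_one hB] at h1
  rw [Measure.snd_apply hB, ← h1, ← lintegral_indicator_one (measurable_snd hB)]
  rfl

/-- The second moments of the pulled back measures increase with time. -/
theorem monotone_lintegral_twoPointLaw (hφ : IsWhiteNoiseRDS P θ φ ℱ)
    (hρ : IsInvariantLaw P φ ρ) {f : E → ℝ≥0∞} (hf : Measurable f) {C : ℝ≥0}
    (hC : ∀ x, f x ≤ C) :
    Monotone fun t : ℝ≥0 => ∫⁻ p, f p.1 * f p.2 ∂(twoPointLaw P φ t (ρ.prod ρ)) := by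
  intro s u hsu
  obtain ⟨t, rfl⟩ := exists_add_of_le hsu
  simp only
  rw [lintegral_twoPointLaw_prod_mul hφ s (-s) hf hf,
    lintegral_twoPointLaw_prod_mul hφ (s + t) (-((s + t : ℝ≥0) : ℝ)) hf hf]
  have hM : ∀ t r, Measurable fun ω => ∫⁻ x, f (φ t (θ r ω) x) ∂ρ := fun t r =>
    (hf.comp ((hφ.measurable_cocycle_apply t).comp
      ((hφ.measurable_shift_const r).prodMap measurable_id))).lintegral_prod_right'
  set M : Ω → ℝ≥0∞ := fun ω => ∫⁻ x, f (φ s (θ (-s) ω) x) ∂ρ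
  set N : Ω → ℝ≥0∞ := fun ω => ∫⁻ x, f (φ (s + t) (θ (-((s + t : ℝ≥0) : ℝ)) ω) x) ∂ρ
  have hbd : ∀ ω, M ω ≤ C := fun ω => by
    simpa using lintegral_mono (μ := ρ) fun x => hC (φ s (θ (-s) ω) x)
  -- Martingale orthogonality: `M` is determined by the noise on `[-s, 0]`, given which `N` has
  -- conditional mean `M`. Together with `2MN ≤ M² + N²` this yields `𝔼[M²] ≤ 𝔼[N²]`.
  have hcross : ∫⁻ ω, M ω * N ω ∂P = ∫⁻ ω, M ω * M ω ∂P := by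
    have hinc := hφ.measurable_increment s (-s)
    rw [add_neg_cancel] at hinc
    have hfm : Measurable[(ℱ (-s) 0).prod mE] (fun p : Ω × E => f (φ s (θ (-s) p.1) p.2)) :=
      hf.comp hinc
    have hMm : Measurable[ℱ (-s) 0] M :=
      @Measurable.lintegral_prod_right' Ω E (ℱ (-s) 0) mE ρ _ _ hfm
    have h := lintegral_pullback_past hφ hρ s t (G := fun ω x => M ω * f (φ s (θ (-s) ω) x))
      ((hMm.comp (@measurable_fst Ω E (ℱ (-s) 0) mE)).mul hfm)
    simp only [← hφ.pullback_add] at h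
    have h2 : ∀ ω, ∫⁻ x, M ω * f (φ (s + t) (θ (-((s + t : ℝ≥0) : ℝ)) ω) x) ∂ρ = M ω * N ω :=
      fun ω => lintegral_const_mul _ (hf.comp (hφ.continuous_cocycle _ _).measurable)
    have h3 : ∀ ω, ∫⁻ x, M ω * f (φ s (θ (-s) ω) x) ∂ρ = M ω * M ω :=
      fun ω => lintegral_const_mul _ (hf.comp (hφ.continuous_cocycle _ _).measurable)
    simpa only [h2, h3] using h
  have hMm : Measurable M := hM _ _
  have hNm : Measurable N := hM _ _
  have hle : ∀ a b : ℝ≥0∞, a * b + a * b ≤ a * a + b * b := fun a b => by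
    rcases le_total a b with h | h
    · obtain ⟨c, rfl⟩ := exists_add_of_le h
      calc a * (a + c) + a * (a + c) = a * a + (a * a + a * c + a * c) := by ring
        _ ≤ a * a + (a * a + a * c + a * c + c * c) :=
          add_le_add le_rfl le_self_add
        _ = _ := by ring
    · obtain ⟨c, rfl⟩ := exists_add_of_le h
      calc (b + c) * b + (b + c) * b = (b * b + b * c + b * c) + b * b := by ring
        _ ≤ (b * b + b * c + b * c + c * c) + b * b :=
          add_le_add le_self_add le_rfl
        _ = _ := by ring
  have hfin : ∫⁻ ω, M ω * M ω ∂P ≠ ∞ := by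
    refine ((lintegral_mono fun ω => mul_le_mul' (hbd ω) (hbd ω)).trans_lt ?_).ne
    exact lintegral_const_lt_top (by finiteness)
  have hsum : ∫⁻ ω, M ω * M ω ∂P + ∫⁻ ω, M ω * M ω ∂P
      ≤ ∫⁻ ω, M ω * M ω ∂P + ∫⁻ ω, N ω * N ω ∂P := by
    nth_rw 1 2 [← hcross]
    have h1 := lintegral_add_left (μ := P) (hMm.mul hNm) (fun ω => M ω * N ω)
    have h2 := lintegral_add_left (μ := P) (hMm.mul hMm) (fun ω => N ω * N ω)
    simp only [Pi.mul_apply] at h1 h2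
    rw [← h1, ← h2]
    exact lintegral_mono fun ω => hle _ _
  exact (ENNReal.add_le_add_iff_left hfin).1 hsum

end TwoPoint

/-! ### Limit laws of the two-point motion. -/

section TwoPointLimit

variable {Ω E : Type*} [mΩ : MeasurableSpace Ω] [MetricSpace E] [SecondCountableTopology E]
  [mE : MeasurableSpace E] [BorelSpace E] {P : Measure Ω} [IsProbabilityMeasure P]
  {θ : ℝ → Ω → Ω} {φ : ℝ≥0 → Ω → E → E} {ℱ : ℝ → ℝ → MeasurableSpace Ω}
  {ρ : Measure E} [IsProbabilityMeasure ρ]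

theorem tendsto_lintegral_mul_of_tendsto {κ : ℕ → ProbabilityMeasure (E × E)}
    {κ₀ : ProbabilityMeasure (E × E)} (h : Tendsto κ atTop (𝓝 κ₀)) (F G : E →ᵇ ℝ≥0) :
    Tendsto (fun k => ∫⁻ p, (F p.1 : ℝ≥0∞) * G p.2 ∂(κ k : Measure (E × E))) atTop
      (𝓝 (∫⁻ p, (F p.1 : ℝ≥0∞) * G p.2 ∂(κ₀ : Measure (E × E)))) := by
  have := ProbabilityMeasure.tendsto_iff_forall_lintegral_tendsto.1 h
    (F.compContinuous ⟨Prod.fst, continuous_fst⟩ * G.compContinuous ⟨Prod.snd, continuous_snd⟩)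
  simpa using this

/-- A limit law of the two-point motion started from `ρ ⊗ ρ` along a sequence of times tending
to infinity is symmetric, and its values on squares do not depend on the sequence. -/
theorem lintegral_mul_of_tendsto_twoPointLaw (hφ : IsWhiteNoiseRDS P θ φ ℱ)
    (hρ : IsInvariantLaw P φ ρ) {s : ℕ → ℝ≥0} (hs : Tendsto s atTop atTop)
    {κ : ℕ → ProbabilityMeasure (E × E)}
    (hκ : ∀ k, (κ k : Measure (E × E)) = twoPointLaw P φ (s k) (ρ.prod ρ))
    {κ₀ : ProbabilityMeasure (E × E)} (h : Tendsto κ atTop (𝓝 κ₀)) :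
    (∀ F G : E →ᵇ ℝ≥0, ∫⁻ p, (F p.1 : ℝ≥0∞) * G p.2 ∂(κ₀ : Measure (E × E))
      = ∫⁻ p, (G p.1 : ℝ≥0∞) * F p.2 ∂(κ₀ : Measure (E × E))) ∧
    ∀ F : E →ᵇ ℝ≥0, ∫⁻ p, (F p.1 : ℝ≥0∞) * F p.2 ∂(κ₀ : Measure (E × E))
      = ⨆ t : ℝ≥0, ∫⁻ p, (F p.1 : ℝ≥0∞) * F p.2 ∂(twoPointLaw P φ t (ρ.prod ρ)) := by
  have hm : ∀ F : E →ᵇ ℝ≥0, Measurable fun x => (F x : ℝ≥0∞) := fun F =>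
    F.continuous.measurable.coe_nnreal_ennreal
  refine ⟨fun F G => tendsto_nhds_unique (tendsto_lintegral_mul_of_tendsto h F G) ?_,
    fun F => tendsto_nhds_unique (tendsto_lintegral_mul_of_tendsto h F F) ?_⟩
  · refine (tendsto_lintegral_mul_of_tendsto h G F).congr fun k => ?_
    rw [hκ, lintegral_twoPointLaw_prod_mul hφ (s k) 0 (hm F) (hm G),
      lintegral_twoPointLaw_prod_mul hφ (s k) 0 (hm G) (hm F)]
    exact lintegral_congr fun ω => mul_comm _ _
  · simp only [hκ]
    refine (tendsto_atTop_iSup (monotone_lintegral_twoPointLaw hφ hρ (hm F)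
      (C := nndist F 0) fun x => ?_)).comp hs
    exact_mod_cast BoundedContinuousFunction.NNReal.upper_bound F x

/-- Both marginals stay equal to `ρ`, which is tight on a complete separable space; tightness of the
marginals gives tightness on the product, and Prokhorov's theorem applies. -/
theorem exists_tendsto_twoPointLaw [CompleteSpace E] (hφ : IsWhiteNoiseRDS P θ φ ℱ)
    (hρ : IsInvariantLaw P φ ρ) :
    ∃ (κ : ℕ → ProbabilityMeasure (E × E)) (κ₀ : ProbabilityMeasure (E × E)) (n : ℕ → ℕ),
      StrictMono n ∧ Tendsto κ atTop (𝓝 κ₀) ∧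
      ∀ k, (κ k : Measure (E × E)) = twoPointLaw P φ (n k) (ρ.prod ρ) := by
  let κ : ℕ → ProbabilityMeasure (E × E) := fun n =>
    ⟨twoPointLaw P φ n (ρ.prod ρ), isProbabilityMeasure_twoPointLaw hφ _ _⟩
  have htight : IsTightMeasureSet {(x : Measure (E × E)) | ∃ μ ∈ Set.range κ, (μ : Measure _) = x} := by
    refine IsTightMeasureSet.prodMk (isTightMeasureSet_singleton (μ := ρ) |>.subset ?_)
      (isTightMeasureSet_singleton (μ := ρ) |>.subset ?_)
    · rintro _ ⟨_, ⟨_, ⟨n, rfl⟩, rfl⟩, rfl⟩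
      exact fst_twoPointLaw_prod hφ hρ n
    · rintro _ ⟨_, ⟨_, ⟨n, rfl⟩, rfl⟩, rfl⟩
      exact snd_twoPointLaw_prod hφ hρ n
  obtain ⟨κ₀, -, n, hn, h⟩ := (isCompact_closure_of_isTightMeasureSet htight).tendsto_subseq
    (x := κ) fun n => subset_closure ⟨n, rfl⟩
  exact ⟨κ ∘ n, κ₀, n, hn, h, fun k => rfl⟩

theorem fst_snd_of_tendsto_twoPointLaw (hφ : IsWhiteNoiseRDS P θ φ ℱ)
    (hρ : IsInvariantLaw P φ ρ) {s : ℕ → ℝ≥0} {κ : ℕ → ProbabilityMeasure (E × E)}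
    (hκ : ∀ k, (κ k : Measure (E × E)) = twoPointLaw P φ (s k) (ρ.prod ρ))
    {κ₀ : ProbabilityMeasure (E × E)} (h : Tendsto κ atTop (𝓝 κ₀)) :
    (κ₀ : Measure (E × E)).fst = ρ ∧ (κ₀ : Measure (E × E)).snd = ρ := by
  have h1 : ∀ (g : E × E → E) (hg : Continuous g),
      (∀ k, (κ k : Measure (E × E)).map g = ρ) → (κ₀ : Measure (E × E)).map g = ρ := by
    intro g hg hk
    have h2 := ProbabilityMeasure.tendsto_map_of_tendsto_of_continuous κ κ₀ h hg
    have h3 : (fun k => (κ k).map hg.measurable.aemeasurable)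
        = fun _ => (⟨ρ, inferInstance⟩ : ProbabilityMeasure E) := by
      ext1 k
      exact Subtype.ext (hk k)
    rw [h3] at h2
    exact congrArg (fun μ : ProbabilityMeasure E => (μ : Measure E))
      (tendsto_nhds_unique h2 tendsto_const_nhds)
  exact ⟨h1 _ continuous_fst fun k => by rw [hκ]; exact fst_twoPointLaw_prod hφ hρ _,
    h1 _ continuous_snd fun k => by rw [hκ]; exact snd_twoPointLaw_prod hφ hρ _⟩

/-- Limit laws of the two-point motion started from `ρ ⊗ ρ` are stationary. -/
theorem twoPointLaw_eq_of_tendsto (hφ : IsWhiteNoiseRDS P θ φ ℱ)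
    (hρ : IsInvariantLaw P φ ρ) {s : ℕ → ℝ≥0} (hs : Tendsto s atTop atTop)
    {κ : ℕ → ProbabilityMeasure (E × E)}
    (hκ : ∀ k, (κ k : Measure (E × E)) = twoPointLaw P φ (s k) (ρ.prod ρ))
    {κ₀ : ProbabilityMeasure (E × E)} (h : Tendsto κ atTop (𝓝 κ₀)) (t : ℝ≥0) :
    twoPointLaw P φ t κ₀ = κ₀ := by
  let push : ProbabilityMeasure (E × E) → ProbabilityMeasure (E × E) := fun κ =>
    ⟨twoPointLaw P φ t κ, isProbabilityMeasure_twoPointLaw hφ _ _⟩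
  have h' : Tendsto (fun k => push (κ k)) atTop (𝓝 (push κ₀)) :=
    ProbabilityMeasure.tendsto_iff_forall_integral_tendsto.2 (tendsto_twoPointLaw hφ t h)
  have hpush : ∀ k, (push (κ k) : Measure (E × E)) = twoPointLaw P φ (s k + t) (ρ.prod ρ) :=
    fun k => by rw [twoPointLaw_add hφ, ← hκ]; rfl
  obtain ⟨h1, h2⟩ := lintegral_mul_of_tendsto_twoPointLaw hφ hρ hs hκ h
  -- The times `s k + t` also tend to infinity, so the pushed limit integrates squares to the same
  -- suprema.
  obtain ⟨h3, h4⟩ := lintegral_mul_of_tendsto_twoPointLaw hφ hρ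
    (tendsto_atTop_mono (fun k => le_self_add) hs) hpush h'
  have := Measure.ext_of_lintegral_mul_self h3 h1 fun F => (h4 F).trans (h2 F).symm
  exact this

/-- A stationary law of the two-point motion which is carried by pairs of points satisfying
pointwise stability is carried by the diagonal. -/
theorem measure_ne_eq_zero_of_isPointwiseStableOn (hφ : IsWhiteNoiseRDS P θ φ ℱ) {U : Set E}
    (hU : IsPointwiseStableOn P φ U) {κ : Measure (E × E)} [IsProbabilityMeasure κ]
    (hκ : ∀ t, twoPointLaw P φ t κ = κ) (hκU : ∀ᵐ p ∂κ, p.1 ∈ U ∧ p.2 ∈ U) :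
    κ {p | p.1 ≠ p.2} = 0 := by
  obtain ⟨t, -, -, hδ⟩ := hU
  set A : ℕ → Set (E × E) := fun m => {p | dist p.1 p.2 ≤ 1 / ((m : ℝ) + 1)} with hA
  set D : Set (E × E) := {p | p.1 ≠ p.2} with hD
  have hAm : ∀ m, MeasurableSet (A m) := fun m =>
    (isClosed_le continuous_dist continuous_const).measurableSet
  have hDm : MeasurableSet D := (isClosed_eq continuous_fst continuous_snd).measurableSet.compl
  let g : ℕ → ℕ → E × E → ℝ≥0∞ := fun m n p =>
    P {ω | dist (φ (t n) ω p.1) (φ (t n) ω p.2) ≤ 1 / ((m : ℝ) + 1)}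
  have hgm : ∀ m n, Measurable (g m n) := fun m n =>
    measurable_measure_prodMk_right (μ := P)
      (s := (fun q : Ω × E × E => (φ (t n) q.1 q.2.1, φ (t n) q.1 q.2.2)) ⁻¹' A m)
      (hφ.measurable_twoPoint (t n) (hAm m))
  have hκA : ∀ m n, κ (A m) = ∫⁻ p, g m n p ∂κ := fun m n => by
    conv_lhs => rw [← hκ (t n)]
    rw [← lintegral_indicator_one (hAm m),
      lintegral_twoPointLaw hφ _ _ (measurable_one.indicator (hAm m))]
    refine lintegral_congr fun p => ?_
    have hmeas : MeasurableSet {ω | dist (φ (t n) ω p.1) (φ (t n) ω p.2) ≤ 1 / ((m : ℝ) + 1)} :=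
      measurable_prodMk_right (hφ.measurable_twoPoint (t n) (hAm m))
    exact lintegral_indicator_one hmeas
  have hsub : ∀ m, Dᶜ ⊆ A m := fun m p hp => by
    have : p.1 = p.2 := by simpa [hD] using hp
    simp only [hA, Set.mem_ofPred_eq, this, dist_self]
    positivity
  -- Diagonal points lie in `A m` and satisfy `g m n = 1`, so their contribution cancels from the
  -- stationarity identity `hκA`.
  have hle : ∀ m n, ∫⁻ p in D, g m n p ∂κ ≤ κ (A m ∩ D) := fun m n => by
    have h1 : κ (A m) = κ Dᶜ + κ (A m ∩ D) := by
      rw [← measure_inter_add_sdiff (A m) hDm, Set.sdiff_eq,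
        Set.inter_eq_self_of_subset_right (hsub m), add_comm]
    have h2 : κ Dᶜ ≤ ∫⁻ p in Dᶜ, g m n p ∂κ := by
      have : ∫⁻ _ in Dᶜ, 1 ∂κ = κ Dᶜ := by simp
      rw [← this]
      refine setLIntegral_mono (hgm m n) fun p hp => ?_
      have hp : p.1 = p.2 := by simpa [hD] using hp
      have : {ω | dist (φ (t n) ω p.1) (φ (t n) ω p.2) ≤ 1 / ((m : ℝ) + 1)} = Set.univ := by
        refine Set.eq_univ_of_forall fun ω => ?_
        simp only [Set.mem_ofPred_eq, hp, dist_self]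
        positivity
      simp only [g, this, measure_univ, le_refl]
    have h3 := hκA m n
    rw [h1, ← lintegral_add_compl _ hDm, add_comm] at h3
    refine (ENNReal.add_le_add_iff_right (measure_ne_top κ Dᶜ)).1 ?_
    rw [h3]
    gcongr
  have hlim : Tendsto (fun m => κ (A m ∩ D)) atTop (𝓝 0) := by
    have hempty : ⋂ m, A m ∩ D = ∅ := by
      refine Set.eq_empty_of_forall_notMem fun p hp => ?_
      rw [Set.mem_iInter] at hp
      have h0 : dist p.1 p.2 ≤ 0 := ge_of_tendsto' tendsto_one_div_add_atTop_nhds_zero_nat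
        fun m => (hp m).1
      exact (hp 0).2 (dist_le_zero.1 h0)
    rw [← measure_empty (μ := κ), ← hempty]
    refine tendsto_measure_iInter_atTop (fun m => ((hAm m).inter hDm).nullMeasurableSet) ?_
      ⟨0, measure_ne_top _ _⟩
    intro m n hmn p hp
    have h1 : dist p.1 p.2 ≤ 1 / ((n : ℝ) + 1) := hp.1
    exact ⟨h1.trans (Nat.one_div_le_one_div hmn), hp.2⟩
  -- A measurable substitute for `δ(x, y)`, which need not be measurable: it dominates `δ` on `U ×
  -- U`. Independence of `δ` from `η` is what allows the infimum over `m`.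
  let d : E × E → ℝ≥0∞ := fun p => ⨅ m, liminf (fun n => g m n p) atTop
  have hdm : Measurable d := .iInf fun m => .liminf (hgm m)
  have hd0 : ∫⁻ p in D, d p ∂κ = 0 := by
    refine le_antisymm (ge_of_tendsto' hlim fun m => ?_) bot_le
    calc ∫⁻ p in D, d p ∂κ ≤ ∫⁻ p in D, liminf (fun n => g m n p) atTop ∂κ :=
          lintegral_mono fun p => iInf_le _ m
      _ ≤ liminf (fun n => ∫⁻ p in D, g m n p ∂κ) atTop := lintegral_liminf_le (hgm m)
      _ ≤ liminf (fun _ : ℕ => κ (A m ∩ D)) atTop := liminf_le_liminf (.of_forall (hle m))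
      _ = κ (A m ∩ D) := by simp
  rw [lintegral_eq_zero_iff hdm, Filter.EventuallyEq, ae_restrict_iff' hDm] at hd0
  have : ∀ᵐ p ∂κ, p ∉ D := by
    filter_upwards [hd0, hκU] with p hp hpU hpD
    obtain ⟨δ, hδ0, hδ1⟩ := hδ p.1 hpU.1 p.2 hpU.2
    have : ENNReal.ofReal δ ≤ d p := le_iInf fun m => hδ1 _ (by positivity)
    rw [hp hpD] at this
    exact absurd this (by simpa using hδ0)
  simpa [ae_iff] using this

end TwoPointLimit

/-! ### Martingale convergence of the pulled back masses. -/

/-- A sequence tending to infinity factors through a monotone sequence tending to infinity. -/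
theorem exists_monotone_factor_of_tendsto_atTop {r : ℕ → ℝ≥0} (hr : Tendsto r atTop atTop) :
    ∃ (u : ℕ → ℝ≥0) (i : ℕ → ℕ), Monotone u ∧ Tendsto i atTop atTop ∧ ∀ k, r k = u (i k) := by
  -- The range of `r` has finitely many points below each bound, hence is order isomorphic to `ℕ`;
  -- the extra point `0` supplies a bottom element.
  let S : Set ℝ≥0 := insert 0 (Set.range r)
  have hfin : ∀ b, (S ∩ Set.Iic b).Finite := fun b => by
    have h1 : {k | ¬ b < r k}.Finite := by
      have := hr.eventually_gt_atTop b
      rwa [← Nat.cofinite_eq_atTop] at this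
    refine ((h1.image r).insert 0).subset ?_
    rintro x ⟨hx | ⟨k, rfl⟩, hxb⟩
    · exact Or.inl hx
    · exact Or.inr ⟨k, not_lt.2 hxb, rfl⟩
  let _ : LocallyFiniteOrder S := LocallyFiniteOrder.ofFiniteIcc fun a b =>
    Set.Finite.of_finite_image ((hfin b).subset (by
      rintro _ ⟨x, hx, rfl⟩
      exact ⟨x.2, hx.2⟩)) Subtype.val_injective.injOn
  let _ : OrderBot S := { bot := ⟨0, Or.inl rfl⟩, bot_le := fun a => zero_le (a := a.1) }
  have : NoMaxOrder S := ⟨fun a => by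
    obtain ⟨k, hk⟩ := (hr.eventually_gt_atTop a.1).exists
    exact ⟨⟨r k, Or.inr ⟨k, rfl⟩⟩, hk⟩⟩
  let _ := LinearLocallyFiniteOrder.succOrder S
  let _ := LinearLocallyFiniteOrder.predOrder S
  let e : S ≃o ℕ := orderIsoNatOfLinearSuccPredArch
  refine ⟨fun n => (e.symm n).1, fun k => e ⟨r k, Or.inr ⟨k, rfl⟩⟩, fun a b hab => e.symm.monotone hab,
    tendsto_atTop.2 fun N => ?_, fun k => by simp⟩
  filter_upwards [hr.eventually_ge_atTop (e.symm N).1] with k hk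
  exact e.symm_apply_le.1 hk

section Martingale

variable {Ω E : Type*} [mΩ : MeasurableSpace Ω] [MetricSpace E] [SecondCountableTopology E]
  [mE : MeasurableSpace E] [BorelSpace E] {P : Measure Ω} [IsProbabilityMeasure P]
  {θ : ℝ → Ω → Ω} {φ : ℝ≥0 → Ω → E → E} {ℱ : ℝ → ℝ → MeasurableSpace Ω}
  {ρ : Measure E} [IsProbabilityMeasure ρ]

theorem isProbabilityMeasure_pullbackImage (hφ : IsWhiteNoiseRDS P θ φ ℱ) (t : ℝ≥0) (ω : Ω) :
    IsProbabilityMeasure (pullbackImage θ φ ρ t ω) :=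
  Measure.isProbabilityMeasure_map (hφ.continuous_cocycle _ _).measurable.aemeasurable

theorem lintegral_pullbackImage (hφ : IsWhiteNoiseRDS P θ φ ℱ) (t : ℝ≥0) (ω : Ω)
    {f : E → ℝ≥0∞} (hf : Measurable f) :
    ∫⁻ x, f x ∂(pullbackImage θ φ ρ t ω) = ∫⁻ x, f (φ t (θ (-(t : ℝ)) ω) x) ∂ρ :=
  lintegral_map hf (hφ.continuous_cocycle _ _).measurable

theorem pullbackImage_apply_eq_lintegral (hφ : IsWhiteNoiseRDS P θ φ ℱ) (t : ℝ≥0) (ω : Ω)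
    {B : Set E} (hB : MeasurableSet B) :
    pullbackImage θ φ ρ t ω B
      = ∫⁻ x, B.indicator (1 : E → ℝ≥0∞) (φ t (θ (-(t : ℝ)) ω) x) ∂ρ := by
  rw [← lintegral_pullbackImage hφ t ω (measurable_one.indicator hB), lintegral_indicator_one hB]

theorem measurable_pullbackImage_apply (hφ : IsWhiteNoiseRDS P θ φ ℱ) (t : ℝ≥0) {B : Set E}
    (hB : MeasurableSet B) :
    Measurable[ℱ (-t) 0] fun ω => pullbackImage θ φ ρ t ω B := by
  have hinc := hφ.measurable_increment t (-t)
  rw [add_neg_cancel] at hinc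
  simp only [pullbackImage_apply_eq_lintegral hφ t _ hB]
  exact @Measurable.lintegral_prod_right' Ω E (ℱ (-t) 0) mE ρ _
    (fun p => B.indicator 1 (φ t (θ (-(t : ℝ)) p.1) p.2))
    ((measurable_one.indicator hB).comp hinc)

/-- This is the martingale identity: the older noise, on `[-(s + t), -s]`, is independent of `A` and
preserves `ρ` on average. -/
theorem setLIntegral_pullbackImage_add (hφ : IsWhiteNoiseRDS P θ φ ℱ)
    (hρ : IsInvariantLaw P φ ρ) (s t : ℝ≥0) {A : Set Ω} (hA : MeasurableSet[ℱ (-s) 0] A)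
    {B : Set E} (hB : MeasurableSet B) :
    ∫⁻ ω in A, pullbackImage θ φ ρ (s + t) ω B ∂P = ∫⁻ ω in A, pullbackImage θ φ ρ s ω B ∂P := by
  have hA' : MeasurableSet A := hφ.le_ambient _ _ (by simp) _ hA
  have hinc := hφ.measurable_increment s (-s)
  rw [add_neg_cancel] at hinc
  have hf : Measurable (B.indicator (1 : E → ℝ≥0∞)) := measurable_one.indicator hB
  have hAi : Measurable[ℱ (-s) 0] (A.indicator (1 : Ω → ℝ≥0∞)) :=
    Measurable.indicator (@measurable_one ℝ≥0∞ Ω _ (ℱ (-s) 0) _) hA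
  have key := lintegral_pullback_past hφ hρ s t
    (G := fun ω x => A.indicator 1 ω * B.indicator (1 : E → ℝ≥0∞) (φ s (θ (-s) ω) x))
    ((hAi.comp (@measurable_fst Ω E (ℱ (-s) 0) mE)).mul (hf.comp hinc))
  simp only [← hφ.pullback_add] at key
  have h : ∀ r ω, ∫⁻ x, A.indicator 1 ω * B.indicator (1 : E → ℝ≥0∞) (φ r (θ (-(r : ℝ)) ω) x) ∂ρ
      = A.indicator (fun ω => pullbackImage θ φ ρ r ω B) ω := fun r ω => by
    refine (lintegral_const_mul (μ := ρ) _
      (hf.comp (hφ.continuous_cocycle _ _).measurable)).trans ?_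
    simp only [Function.comp_apply]
    rw [← pullbackImage_apply_eq_lintegral hφ r ω hB]
    by_cases hω : ω ∈ A <;> simp [hω]
  rw [← lintegral_indicator hA', ← lintegral_indicator hA']
  simpa only [h] using key

/-- Along a monotone sequence of times, the masses given to a Borel set by the pulled back
measures form a martingale. -/
theorem ae_exists_tendsto_pullbackImage_of_monotone (hφ : IsWhiteNoiseRDS P θ φ ℱ)
    (hρ : IsInvariantLaw P φ ρ) {u : ℕ → ℝ≥0} (hu : Monotone u) {B : Set E}
    (hB : MeasurableSet B) :
    ∀ᵐ ω ∂P, ∃ c, Tendsto (fun n => (pullbackImage θ φ ρ (u n) ω).real B) atTop (𝓝 c) := by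
  let 𝒢 : Filtration ℕ mΩ :=
    { seq := fun n => ℱ (-(u n : ℝ)) 0
      mono' := fun m n hmn => hφ.mono _ _ _ _ (neg_le_neg (by exact_mod_cast hu hmn))
        (by simp) le_rfl
      le' := fun n => hφ.le_ambient _ _ (by simp) }
  have hpr := fun t ω => isProbabilityMeasure_pullbackImage (ρ := ρ) hφ t ω
  have hm : ∀ n, Measurable[𝒢 n] fun ω => (pullbackImage θ φ ρ (u n) ω).real B := fun n =>
    (measurable_pullbackImage_apply hφ (u n) hB).ennreal_toReal
  have hbd : ∀ n ω, ‖(pullbackImage θ φ ρ (u n) ω).real B‖ ≤ 1 := fun n ω => by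
    rw [Real.norm_of_nonneg measureReal_nonneg]
    exact measureReal_le_one
  have hint : ∀ n, Integrable (fun ω => (pullbackImage θ φ ρ (u n) ω).real B) P := fun n =>
    Integrable.of_bound (C := 1) ((hm n).mono (𝒢.le n) le_rfl).aestronglyMeasurable
      (.of_forall (hbd n))
  have hmart : Martingale (fun n ω => (pullbackImage θ φ ρ (u n) ω).real B) 𝒢 P := by
    refine martingale_of_setIntegral_eq_succ (fun n => (hm n).stronglyMeasurable) hint
      fun n A hA => ?_
    obtain ⟨t, ht⟩ := exists_add_of_le (hu n.le_succ)
    have h := setLIntegral_pullbackImage_add hφ hρ (u n) t hA hB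
    rw [← ht] at h
    have hr : ∀ k, ∫ ω in A, (pullbackImage θ φ ρ (u k) ω).real B ∂P
        = (∫⁻ ω in A, pullbackImage θ φ ρ (u k) ω B ∂P).toReal := fun k =>
      integral_toReal ((measurable_pullbackImage_apply hφ (u k) hB).mono (𝒢.le k)
        le_rfl).aemeasurable (.of_forall fun ω => measure_lt_top _ _)
    rw [hr, hr, ← h]
  refine hmart.submartingale.exists_ae_tendsto_of_bdd (R := 1) fun n => ?_
  refine (eLpNorm_le_of_ae_bound (.of_forall (hbd n))).trans ?_
  simp

/-- Along any sequence of times tending to infinity, the masses given to a Borel set by the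
pulled back measures converge, and the limit is the one along the integers. -/
theorem ae_exists_tendsto_pullbackImage (hφ : IsWhiteNoiseRDS P θ φ ℱ)
    (hρ : IsInvariantLaw P φ ρ) {t : ℕ → ℝ≥0} (ht : Tendsto t atTop atTop) {B : Set E}
    (hB : MeasurableSet B) :
    ∀ᵐ ω ∂P, ∃ c, Tendsto (fun n => pullbackImage θ φ ρ (t n) ω B) atTop (𝓝 c) ∧
      Tendsto (fun n : ℕ => pullbackImage θ φ ρ n ω B) atTop (𝓝 c) := by
  -- Interleaving `t` with the integers forces the two limits to coincide.
  let r : ℕ → ℝ≥0 := fun k => if Even k then t (k / 2) else ((k / 2 : ℕ) : ℝ≥0)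
  have h2 : Tendsto (fun k : ℕ => k / 2) atTop atTop := Nat.tendsto_div_const_atTop two_ne_zero
  have hr : Tendsto r atTop atTop :=
    (ht.comp h2).if' (tendsto_natCast_atTop_atTop.comp h2)
  obtain ⟨u, i, hu, hi, hri⟩ := exists_monotone_factor_of_tendsto_atTop hr
  filter_upwards [ae_exists_tendsto_pullbackImage_of_monotone hφ hρ hu hB] with ω ⟨c, hc⟩
  have hpr := fun t => isProbabilityMeasure_pullbackImage (ρ := ρ) hφ t ω
  have hc' : Tendsto (fun n => pullbackImage θ φ ρ (r n) ω B) atTop (𝓝 (ENNReal.ofReal c)) := by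
    refine (ENNReal.tendsto_ofReal (hc.comp hi)).congr fun n => ?_
    simp only [Function.comp_apply, ← hri]
    exact ENNReal.ofReal_toReal (measure_ne_top _ _)
  have hd : Tendsto (fun n : ℕ => 2 * n) atTop atTop :=
    tendsto_id.const_mul_atTop' two_pos
  refine ⟨ENNReal.ofReal c, (hc'.comp hd).congr fun n => ?_,
    (hc'.comp ((tendsto_add_atTop_nat 1).comp hd)).congr fun n => ?_⟩
  · simp [r]
  · have h3 : (2 * n + 1) / 2 = n := by omega
    simp [r, h3]

end Martingale

/-! ### Concentration on shrinking balls. -/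

/-- Two disjoint balls cannot both receive asymptotically full mass, so the distance of two centres
is at most the sum of the radii. -/
theorem cauchySeq_of_tendsto_closedBall {E : Type*} [MetricSpace E] [MeasurableSpace E]
    [BorelSpace E] {ν : ℕ → Measure E} [∀ n, IsProbabilityMeasure (ν n)] {y : ℕ → E}
    (h : ∀ j : ℕ, Tendsto (fun n => ν n (Metric.closedBall (y j) ((1 / 2 : ℝ) ^ j))) atTop (𝓝 1)) :
    CauchySeq y := by
  have hd : ∀ j k, dist (y j) (y k) ≤ (1 / 2 : ℝ) ^ j + (1 / 2 : ℝ) ^ k := fun j k => by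
    by_contra hlt
    have hdisj : Disjoint (Metric.closedBall (y j) ((1 / 2 : ℝ) ^ j))
        (Metric.closedBall (y k) ((1 / 2 : ℝ) ^ k)) :=
      Metric.closedBall_disjoint_closedBall (not_le.1 hlt)
    have hsum := (h j).add (h k)
    have h2 : (1 : ℝ≥0∞) + 1 ≤ 1 := le_of_tendsto' hsum fun n => by
      rw [← measure_union hdisj Metric.isClosed_closedBall.measurableSet]
      exact prob_le_one
    norm_num at h2
  refine cauchySeq_of_le_tendsto_0 (fun N => (1 / 2 : ℝ) ^ N + (1 / 2 : ℝ) ^ N)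
    (fun m n N hm hn => (hd m n).trans (add_le_add
      (pow_le_pow_of_le_one (by norm_num) (by norm_num) hm)
      (pow_le_pow_of_le_one (by norm_num) (by norm_num) hn))) ?_
  simpa using (tendsto_pow_atTop_nhds_zero_of_lt_one (r := (1 / 2 : ℝ)) (by norm_num)
    (by norm_num)).add (tendsto_pow_atTop_nhds_zero_of_lt_one (r := (1 / 2 : ℝ)) (by norm_num)
    (by norm_num))

/-- Probability measures which asymptotically give full mass to balls with vanishing radii
converge to the Dirac mass at the limit of the centres. -/
theorem tendsto_integral_of_tendsto_closedBall {E : Type*} [MetricSpace E] [MeasurableSpace E]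
    [BorelSpace E] {ν : ℕ → Measure E} [hν : ∀ n, IsProbabilityMeasure (ν n)] {y : ℕ → E} {a : E}
    (ha : Tendsto y atTop (𝓝 a))
    (h : ∀ j : ℕ, Tendsto (fun n => ν n (Metric.closedBall (y j) ((1 / 2 : ℝ) ^ j))) atTop (𝓝 1))
    (f : E →ᵇ ℝ) : Tendsto (fun n => ∫ x, f x ∂(ν n)) atTop (𝓝 (f a)) := by
  let ν' : ℕ → ProbabilityMeasure E := fun n => ⟨ν n, hν n⟩
  let δ : ProbabilityMeasure E := ⟨Measure.dirac a, inferInstance⟩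
  have hlim : Tendsto ν' atTop (𝓝 δ) := by
    refine tendsto_of_forall_isOpen_le_liminf' fun G hG => ?_
    by_cases haG : a ∈ G
    · obtain ⟨ε, hε, hball⟩ := Metric.isOpen_iff.1 hG a haG
      have h1 : ∀ᶠ j in atTop, dist (y j) a + (1 / 2 : ℝ) ^ j < ε := by
        have h2 := (tendsto_iff_dist_tendsto_zero.1 ha).add
          (tendsto_pow_atTop_nhds_zero_of_lt_one (r := (1 / 2 : ℝ)) (by norm_num) (by norm_num))
        rw [add_zero] at h2
        exact h2.eventually_lt_const hε
      obtain ⟨j, hj⟩ := h1.exists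
      have hsub : Metric.closedBall (y j) ((1 / 2 : ℝ) ^ j) ⊆ G := fun x hx =>
        hball (by
          have h3 := dist_triangle x (y j) a
          have h4 := Metric.mem_closedBall.1 hx
          exact Metric.mem_ball.2 (by linarith))
      calc (δ : Measure E) G ≤ 1 := prob_le_one
        _ = liminf (fun n => ν n (Metric.closedBall (y j) ((1 / 2 : ℝ) ^ j))) atTop :=
          (h j).liminf_eq.symm
        _ ≤ liminf (fun n => (ν' n : Measure E) G) atTop :=
          liminf_le_liminf (.of_forall fun n => measure_mono hsub)
    · have : (δ : Measure E) G = 0 := by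
        change Measure.dirac a G = 0
        rw [Measure.dirac_apply' _ hG.measurableSet]
        simp [haG]
      rw [this]
      exact bot_le
  have := ProbabilityMeasure.tendsto_iff_forall_integral_tendsto.1 hlim f
  simpa [ν', δ] using this

/-! ### The zero-one law for limiting masses. -/

section ZeroOne

variable {Ω E : Type*} [mΩ : MeasurableSpace Ω] [MetricSpace E] [SecondCountableTopology E]
  [mE : MeasurableSpace E] [BorelSpace E] {P : Measure Ω} [IsProbabilityMeasure P]
  {θ : ℝ → Ω → Ω} {φ : ℝ≥0 → Ω → E → E} {ℱ : ℝ → ℝ → MeasurableSpace Ω}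
  {ρ : Measure E} [IsProbabilityMeasure ρ]

theorem lintegral_pullbackImage_apply (hφ : IsWhiteNoiseRDS P θ φ ℱ) (hρ : IsInvariantLaw P φ ρ)
    (t : ℝ≥0) {B : Set E} (hB : MeasurableSet B) :
    ∫⁻ ω, pullbackImage θ φ ρ t ω B ∂P = ρ B := by
  simp only [pullbackImage_apply_eq_lintegral hφ t _ hB]
  rw [lintegral_cocycle_of_isInvariantLaw hφ hρ t _ (measurable_one.indicator hB),
    lintegral_indicator_one hB]

theorem twoPointLaw_prod_apply (hφ : IsWhiteNoiseRDS P θ φ ℱ) (t : ℝ≥0) {A B : Set E}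
    (hA : MeasurableSet A) (hB : MeasurableSet B) :
    twoPointLaw P φ t (ρ.prod ρ) (A ×ˢ B)
      = ∫⁻ ω, pullbackImage θ φ ρ t ω A * pullbackImage θ φ ρ t ω B ∂P := by
  have h := lintegral_twoPointLaw_prod_mul (ρ := ρ) hφ t (-t) (f := A.indicator 1)
    (g := B.indicator 1) (measurable_one.indicator hA) (measurable_one.indicator hB)
  simp only [← pullbackImage_apply_eq_lintegral hφ t _ hA,
    ← pullbackImage_apply_eq_lintegral hφ t _ hB] at h
  rw [← h, ← lintegral_indicator_one (hA.prod hB)]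
  refine lintegral_congr fun p => ?_
  by_cases h1 : p.1 ∈ A <;> by_cases h2 : p.2 ∈ B <;> simp [h1, h2]

/-- If the two-point motion converges in law to a measure carried by the diagonal, then the
joint mass of a Borel set and its complement vanishes asymptotically. -/
theorem limsup_twoPointLaw_prod_compl (hφ : IsWhiteNoiseRDS P θ φ ℱ)
    (hρ : IsInvariantLaw P φ ρ) {s : ℕ → ℝ≥0} {κ : ℕ → ProbabilityMeasure (E × E)}
    (hκ : ∀ k, (κ k : Measure (E × E)) = twoPointLaw P φ (s k) (ρ.prod ρ))
    {κ₀ : ProbabilityMeasure (E × E)} (h : Tendsto κ atTop (𝓝 κ₀))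
    (hD : (κ₀ : Measure (E × E)) {p | p.1 ≠ p.2} = 0) {B : Set E} (hB : MeasurableSet B) :
    limsup (fun k => twoPointLaw P φ (s k) (ρ.prod ρ) (B ×ˢ Bᶜ)) atTop = 0 := by
  refine le_antisymm (ENNReal.le_of_forall_pos_le_add fun ε hε _ => ?_) bot_le
  have hε' : ((ε / 2 : ℝ≥0) : ℝ≥0∞) ≠ 0 := by
    exact_mod_cast (half_pos hε).ne'
  -- Weak convergence bounds the limsup only on closed sets. Inner approximation costs at most `ε`,
  -- uniformly in `k`, since both marginals are `ρ`.
  obtain ⟨F, hFB, hF, hF'⟩ := hB.exists_isClosed_sdiff_lt (measure_ne_top ρ B) hε'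
  obtain ⟨G, hGB, hG, hG'⟩ := hB.compl.exists_isClosed_sdiff_lt (measure_ne_top ρ Bᶜ) hε'
  have hFG : (κ₀ : Measure (E × E)) (F ×ˢ G) = 0 := by
    refine measure_mono_null (fun p hp => ?_) hD
    intro heq
    exact hGB hp.2 (heq ▸ hFB hp.1)
  have hle : ∀ k, twoPointLaw P φ (s k) (ρ.prod ρ) (B ×ˢ Bᶜ)
      ≤ (κ k : Measure (E × E)) (F ×ˢ G) + ε := fun k => by
    have h1 : B ×ˢ Bᶜ ⊆ F ×ˢ G ∪ (Prod.fst ⁻¹' (B \ F) ∪ Prod.snd ⁻¹' (Bᶜ \ G)) := by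
      rintro p ⟨hp1, hp2⟩
      by_cases h1 : p.1 ∈ F
      · by_cases h2 : p.2 ∈ G
        · exact Or.inl ⟨h1, h2⟩
        · exact Or.inr (Or.inr ⟨hp2, h2⟩)
      · exact Or.inr (Or.inl ⟨hp1, h1⟩)
    have h2 : (κ k : Measure (E × E)) (Prod.fst ⁻¹' (B \ F)) ≤ (ε / 2 : ℝ≥0) := by
      rw [← Measure.fst_apply (hB.diff hF.measurableSet), hκ, fst_twoPointLaw_prod hφ hρ]
      exact hF'.le
    have h3 : (κ k : Measure (E × E)) (Prod.snd ⁻¹' (Bᶜ \ G)) ≤ (ε / 2 : ℝ≥0) := by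
      rw [← Measure.snd_apply (hB.compl.diff hG.measurableSet), hκ, snd_twoPointLaw_prod hφ hρ]
      exact hG'.le
    rw [← hκ]
    refine (measure_mono h1).trans ((measure_union_le _ _).trans ?_)
    gcongr
    refine (measure_union_le _ _).trans ((add_le_add h2 h3).trans ?_)
    rw [← ENNReal.coe_add, add_halves]
  calc limsup (fun k => twoPointLaw P φ (s k) (ρ.prod ρ) (B ×ˢ Bᶜ)) atTop
      ≤ limsup (fun k => (κ k : Measure (E × E)) (F ×ˢ G) + ε) atTop :=
        limsup_le_limsup (.of_forall hle)
    _ ≤ limsup (fun k => (κ k : Measure (E × E)) (F ×ˢ G)) atTop + ε := by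
        exact (limsup_add_const atTop _ _ (by isBoundedDefault) (by isBoundedDefault)).le
    _ ≤ 0 + ε := by
        gcongr
        exact (ProbabilityMeasure.limsup_measure_closed_le_of_tendsto h (hF.prod hG)).trans hFG.le

/-- Under pointwise stability, the pulled back masses of a Borel set converge to `0` or `1`. -/
theorem ae_tendsto_pullbackImage_zero_or_one [CompleteSpace E] (hφ : IsWhiteNoiseRDS P θ φ ℱ)
    (hρ : IsInvariantLaw P φ ρ) (hstab : WeakGlobalPointwiseStability P φ ρ) {B : Set E}
    (hB : MeasurableSet B) :
    ∀ᵐ ω ∂P, Tendsto (fun n : ℕ => pullbackImage θ φ ρ n ω B) atTop (𝓝 0) ∨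
      Tendsto (fun n : ℕ => pullbackImage θ φ ρ n ω B) atTop (𝓝 1) := by
  obtain ⟨κ, κ₀, n, hn, h, hκ⟩ := exists_tendsto_twoPointLaw hφ hρ
  obtain ⟨U, hU, hU1, hstab⟩ := hstab
  have hs : Tendsto (fun k => (n k : ℝ≥0)) atTop atTop :=
    tendsto_natCast_atTop_atTop.comp hn.tendsto_atTop
  obtain ⟨hfst, hsnd⟩ := fst_snd_of_tendsto_twoPointLaw hφ hρ hκ h
  have hUae : ∀ᵐ x ∂ρ, x ∈ U := (prob_compl_eq_zero_iff hU).2 hU1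
  have hκU : ∀ᵐ p ∂(κ₀ : Measure (E × E)), p.1 ∈ U ∧ p.2 ∈ U := by
    rw [← hfst] at hUae
    have h1 := ae_of_ae_map measurable_fst.aemeasurable hUae
    rw [hfst, ← hsnd] at hUae
    exact h1.and (ae_of_ae_map measurable_snd.aemeasurable hUae)
  have hD := measure_ne_eq_zero_of_isPointwiseStableOn hφ hstab
    (twoPointLaw_eq_of_tendsto hφ hρ hs hκ h) hκU
  have hlim := limsup_twoPointLaw_prod_compl hφ hρ hκ h hD hB
  have hmeas : ∀ {A : Set E}, MeasurableSet A → ∀ k : ℕ,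
      Measurable fun ω => pullbackImage θ φ ρ k ω A := fun hA k =>
    (measurable_pullbackImage_apply hφ k hA).mono (hφ.le_ambient _ _ (by simp)) le_rfl
  have hm : ∀ k, Measurable fun ω =>
      pullbackImage θ φ ρ (n k) ω B * pullbackImage θ φ ρ (n k) ω Bᶜ := fun k =>
    (hmeas hB (n k)).mul (hmeas hB.compl (n k))
  have h0 : ∫⁻ ω, liminf (fun k =>
      pullbackImage θ φ ρ (n k) ω B * pullbackImage θ φ ρ (n k) ω Bᶜ) atTop ∂P = 0 := by
    refine le_antisymm ((lintegral_liminf_le hm).trans ?_) bot_le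
    rw [← hlim]
    simp only [twoPointLaw_prod_apply hφ _ hB hB.compl]
    exact liminf_le_limsup
  rw [lintegral_eq_zero_iff (.liminf hm)] at h0
  filter_upwards [h0, ae_exists_tendsto_pullbackImage hφ hρ hs hB] with ω hω ⟨c, _, hc⟩
  have hpr := fun t => isProbabilityMeasure_pullbackImage (ρ := ρ) hφ t ω
  have hc' : Tendsto (fun k : ℕ => pullbackImage θ φ ρ k ω Bᶜ) atTop (𝓝 (1 - c)) := by
    simp only [prob_compl_eq_one_sub hB]
    exact ENNReal.Tendsto.sub tendsto_const_nhds hc (Or.inl ENNReal.one_ne_top)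
  have hc1 : c ≤ 1 := le_of_tendsto' hc fun k => prob_le_one
  have hprod := (ENNReal.Tendsto.mul hc (Or.inr (by finiteness)) hc'
    (Or.inr (ne_top_of_le_ne_top ENNReal.one_ne_top hc1))).comp hn.tendsto_atTop
  have h2 : c * (1 - c) = 0 := hprod.liminf_eq.symm.trans hω
  rcases mul_eq_zero.1 h2 with h3 | h3
  · exact Or.inl (h3 ▸ hc)
  · exact Or.inr (le_antisymm hc1 (tsub_eq_zero_iff_le.1 h3) ▸ hc)

/-- Countably many sets covering the space cannot all lose their mass in the pullback limit. -/
theorem ae_exists_not_tendsto_zero (hφ : IsWhiteNoiseRDS P θ φ ℱ) (hρ : IsInvariantLaw P φ ρ)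
    {B : ℕ → Set E} (hB : ∀ i, MeasurableSet (B i)) (hcov : ⋃ i, B i = Set.univ) :
    ∀ᵐ ω ∂P, ∃ i, ¬ Tendsto (fun n : ℕ => pullbackImage θ φ ρ n ω (B i)) atTop (𝓝 0) := by
  let V : ℕ → Set E := fun m => ⋃ i ∈ Finset.range m, B i
  have hV : ∀ m, MeasurableSet (V m) := fun m =>
    Finset.measurableSet_biUnion _ fun i _ => hB i
  have hmeas : ∀ m (k : ℕ), Measurable fun ω => pullbackImage θ φ ρ k ω (V m)ᶜ := fun m k =>
    (measurable_pullbackImage_apply hφ k (hV m).compl).mono (hφ.le_ambient _ _ (by simp)) le_rfl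
  let d : Ω → ℝ≥0∞ := fun ω => ⨅ m, liminf (fun n : ℕ => pullbackImage θ φ ρ n ω (V m)ᶜ) atTop
  have hρV : Tendsto (fun m => ρ (V m)ᶜ) atTop (𝓝 0) := by
    have hempty : ⋂ m, (V m)ᶜ = ∅ := by
      refine Set.eq_empty_of_forall_notMem fun x hx => ?_
      obtain ⟨i, hi⟩ := Set.mem_iUnion.1 (hcov ▸ Set.mem_univ x)
      exact Set.mem_iInter.1 hx (i + 1)
        (Set.mem_biUnion (Finset.mem_coe.2 (Finset.self_mem_range_succ i)) hi)
    rw [← measure_empty (μ := ρ), ← hempty]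
    refine tendsto_measure_iInter_atTop (fun m => (hV m).compl.nullMeasurableSet) ?_
      ⟨0, measure_ne_top _ _⟩
    intro m n hmn
    exact Set.compl_subset_compl.2
      (Set.biUnion_subset_biUnion_left (Finset.range_subset_range.2 hmn))
  have hd0 : ∫⁻ ω, d ω ∂P = 0 := by
    refine le_antisymm (ge_of_tendsto' hρV fun m => ?_) bot_le
    calc ∫⁻ ω, d ω ∂P
        ≤ ∫⁻ ω, liminf (fun n : ℕ => pullbackImage θ φ ρ n ω (V m)ᶜ) atTop ∂P :=
          lintegral_mono fun ω => iInf_le _ m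
      _ ≤ liminf (fun n : ℕ => ∫⁻ ω, pullbackImage θ φ ρ n ω (V m)ᶜ ∂P) atTop :=
          lintegral_liminf_le (hmeas m)
      _ = ρ (V m)ᶜ := by
          simp [lintegral_pullbackImage_apply hφ hρ _ (hV m).compl]
  rw [lintegral_eq_zero_iff (.iInf fun m => .liminf (hmeas m))] at hd0
  filter_upwards [hd0] with ω hω
  by_contra! hall
  have hpr := fun t => isProbabilityMeasure_pullbackImage (ρ := ρ) hφ t ω
  -- If every `B i` lost its mass, so would each finite union `V m`, making `d ω ≥ 1`; but `d` has
  -- mean at most `ρ (V m)ᶜ`, which tends to `0`.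
  have h1 : (1 : ℝ≥0∞) ≤ d ω := le_iInf fun m => by
    have h2 : Tendsto (fun n : ℕ => 1 - ∑ i ∈ Finset.range m, pullbackImage θ φ ρ n ω (B i))
        atTop (𝓝 1) := by
      have h3 := tendsto_finsetSum (Finset.range m) fun i _ => hall i
      simpa using ENNReal.Tendsto.sub tendsto_const_nhds h3 (Or.inl ENNReal.one_ne_top)
    rw [← h2.liminf_eq]
    refine liminf_le_liminf (.of_forall fun n => ?_)
    rw [prob_compl_eq_one_sub (hV m)]
    exact tsub_le_tsub_left (measure_biUnion_finset_le _ _) 1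
  exact absurd (h1.trans_eq hω) (by simp)

end ZeroOne

/-! ### Construction of the random point. -/

/-- The limit of the masses of the pulled back measures along the integers. -/
noncomputable def pullbackLimit {Ω E : Type*} [MeasurableSpace E] (θ : ℝ → Ω → Ω)
    (φ : ℝ≥0 → Ω → E → E) (ρ : Measure E) (B : Set E) (ω : Ω) : ℝ≥0∞ :=
  limsup (fun n : ℕ => pullbackImage θ φ ρ n ω B) atTop

section Equilibrium

variable {Ω E : Type*} [mΩ : MeasurableSpace Ω] [MetricSpace E] [SecondCountableTopology E]
  [mE : MeasurableSpace E] [BorelSpace E] {P : Measure Ω} [IsProbabilityMeasure P]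
  {θ : ℝ → Ω → Ω} {φ : ℝ≥0 → Ω → E → E} {ℱ : ℝ → ℝ → MeasurableSpace Ω}
  {ρ : Measure E} [IsProbabilityMeasure ρ]

theorem measurable_pullbackLimit (hφ : IsWhiteNoiseRDS P θ φ ℱ) {B : Set E}
    (hB : MeasurableSet B) : Measurable[pastSigma ℱ 0] (pullbackLimit θ φ ρ B) := by
  refine @Measurable.limsup _ _ _ _ _ (pastSigma ℱ 0) _ _ _ _ fun n => ?_
  refine (measurable_pullbackImage_apply hφ n hB).mono ?_ le_rfl
  exact le_iSup₂_of_le (-((n : ℝ≥0) : ℝ)) (by simp) le_rfl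

/-- A measurable choice, for each scale `j`, of the first ball in a sequence of balls to which
the pulled back measures asymptotically give full mass. -/
theorem exists_measurable_index (hφ : IsWhiteNoiseRDS P θ φ ℱ) {B : ℕ → Set E}
    (hB : ∀ i, MeasurableSet (B i)) :
    ∃ g : Ω → ℕ, Measurable[pastSigma ℱ 0] g ∧
      ∀ ω, (∃ i, pullbackLimit θ φ ρ (B i) ω = 1) → pullbackLimit θ φ ρ (B (g ω)) ω = 1 := by
  classical
  -- The second alternative makes the search succeed for every `ω`, with index `0` when no set has
  -- limiting mass `1`, so that `g` is measurable without discarding a null set.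
  let p : Ω → ℕ → Prop := fun ω i =>
    pullbackLimit θ φ ρ (B i) ω = 1 ∨ ∀ i', pullbackLimit θ φ ρ (B i') ω ≠ 1
  have hp : ∀ ω, ∃ i, p ω i := fun ω => by
    by_cases h : ∃ i, pullbackLimit θ φ ρ (B i) ω = 1
    · exact h.imp fun i hi => Or.inl hi
    · exact ⟨0, Or.inr (not_exists.1 h)⟩
  refine ⟨fun ω => Nat.find (hp ω), ?_, fun ω hω => ?_⟩
  · refine @measurable_find Ω (pastSigma ℱ 0) p _ hp fun i => ?_
    have h1 : ∀ i, MeasurableSet[pastSigma ℱ 0] {ω | pullbackLimit θ φ ρ (B i) ω = 1} := fun i =>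
      measurable_pullbackLimit hφ (hB i) (measurableSet_singleton 1)
    have h2 : {ω | p ω i} = {ω | pullbackLimit θ φ ρ (B i) ω = 1} ∪
        ⋂ i', {ω | pullbackLimit θ φ ρ (B i') ω = 1}ᶜ := by
      ext ω
      simp [p]
    rw [h2]
    exact (h1 i).union (.iInter fun i' => (h1 i').compl)
  · obtain ⟨i, hi⟩ := hω
    exact (Nat.find_spec (hp ω)).resolve_right fun h => h i hi

/-- Under weak global pointwise stability there is a random point, measurable with respect to
the past, to which the pulled back measures converge along every sequence of times. -/
theorem exists_random_point [CompleteSpace E] (hφ : IsWhiteNoiseRDS P θ φ ℱ)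
    (hρ : IsInvariantLaw P φ ρ) (hstab : WeakGlobalPointwiseStability P φ ρ) :
    ∃ a : Ω → E, Measurable[pastSigma ℱ 0] a ∧
      ∀ t : ℕ → ℝ≥0, Tendsto t atTop atTop → ∀ᵐ ω ∂P, ∀ f : E →ᵇ ℝ,
        Tendsto (fun k => ∫ y, f y ∂(pullbackImage θ φ ρ (t k) ω)) atTop (𝓝 (f (a ω))) := by
  have : Nonempty E := nonempty_of_isProbabilityMeasure ρ
  let x := TopologicalSpace.denseSeq E
  let B : ℕ → ℕ → Set E := fun j i => Metric.closedBall (x i) ((1 / 2 : ℝ) ^ j)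
  have hB : ∀ j i, MeasurableSet (B j i) := fun j i => Metric.isClosed_closedBall.measurableSet
  have hcov : ∀ j, ⋃ i, B j i = Set.univ := fun j => by
    refine Set.eq_univ_of_forall fun z => ?_
    obtain ⟨i, hi⟩ := (TopologicalSpace.denseRange_denseSeq E).exists_dist_lt z
      (ε := (1 / 2 : ℝ) ^ j) (by positivity)
    exact Set.mem_iUnion.2 ⟨i, Metric.mem_closedBall.2 hi.le⟩
  choose g hgm hg using fun j => exists_measurable_index (ρ := ρ) hφ (hB j)
  -- The limit of the centres exists only almost surely; `limUnder` gives a default value elsewhere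
  -- and keeps the map measurable with respect to the past.
  refine ⟨fun ω => limUnder atTop fun j => x (g j ω), ?_, fun t ht => ?_⟩
  · refine StronglyMeasurable.measurable ?_
    refine @StronglyMeasurable.limUnder ℕ Ω E (pastSigma ℱ 0) _ _ atTop _ _ _ _ fun j => ?_
    exact (measurable_from_nat.comp (hgm j)).stronglyMeasurable
  · filter_upwards [ae_all_iff.2 fun j => ae_all_iff.2 fun i =>
        ae_exists_tendsto_pullbackImage hφ hρ ht (hB j i),
      ae_all_iff.2 fun j => ae_all_iff.2 fun i =>
        ae_tendsto_pullbackImage_zero_or_one hφ hρ hstab (hB j i),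
      ae_all_iff.2 fun j => ae_exists_not_tendsto_zero hφ hρ (hB j) (hcov j)] with ω h1 h2 h3
    have hpr := fun k => isProbabilityMeasure_pullbackImage (ρ := ρ) hφ (t k) ω
    have hone : ∀ j, pullbackLimit θ φ ρ (B j (g j ω)) ω = 1 := fun j => by
      obtain ⟨i, hi⟩ := h3 j
      exact hg j ω ⟨i, ((h2 j i).resolve_left hi).limsup_eq⟩
    have hball : ∀ j, Tendsto (fun k => pullbackImage θ φ ρ (t k) ω (B j (g j ω))) atTop (𝓝 1) :=
      fun j => by
        obtain ⟨c, hc, hc'⟩ := h1 j (g j ω)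
        have : c = 1 := hc'.limsup_eq.symm.trans (hone j)
        exact this ▸ hc
    obtain ⟨a, ha⟩ := cauchySeq_tendsto_of_complete (cauchySeq_of_tendsto_closedBall hball)
    rw [ha.limUnder_eq]
    exact tendsto_integral_of_tendsto_closedBall ha hball

end Equilibrium

theorem mainTheorem6 {Ω E : Type*} [MeasurableSpace Ω] [MetricSpace E] [CompleteSpace E]
    [TopologicalSpace.SeparableSpace E] [MeasurableSpace E] [BorelSpace E]
    (P : Measure Ω) [IsProbabilityMeasure P] (θ : ℝ → Ω → Ω) (φ : ℝ≥0 → Ω → E → E)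
    (ℱ : ℝ → ℝ → MeasurableSpace Ω) (hφ : IsWhiteNoiseRDS P θ φ ℱ)
    (ρ : Measure E) [IsProbabilityMeasure ρ] (hρ : IsInvariantLaw P φ ρ)
    (hstab : WeakGlobalPointwiseStability P φ ρ) :
    (∃ μ : Ω → ProbabilityMeasure E, IsStatisticalEquilibrium P θ φ ρ μ) ∧
    ∀ μ : Ω → ProbabilityMeasure E, IsStatisticalEquilibrium P θ φ ρ μ →
      ∃ a : Ω → E, Measurable[pastSigma ℱ 0] a ∧
        ∀ᵐ ω ∂P, (μ ω : Measure E) = Measure.dirac (a ω) := by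
  have : SecondCountableTopology E := UniformSpace.secondCountable_of_separable E
  obtain ⟨a, ham, ha⟩ := exists_random_point hφ hρ hstab
  refine ⟨⟨fun ω => ⟨Measure.dirac (a ω), inferInstance⟩, fun t ht => ?_⟩, fun μ hμ => ⟨a, ham, ?_⟩⟩
  · filter_upwards [ha t ht] with ω hω f
    simpa using hω f
  -- Uniqueness of weak limits along the integers alone identifies any equilibrium.
  · filter_upwards [ha _ tendsto_natCast_atTop_atTop, hμ _ tendsto_natCast_atTop_atTop]
      with ω h1 h2
    refine ext_of_forall_integral_eq_of_IsFiniteMeasure fun f => ?_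
    rw [integral_dirac]
    exact tendsto_nhds_unique (h2 f) (h1 f)
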